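/- **Setting.** Let $n,m\ge 1$, let $\Omega\subseteq\mathbb R^{n+1}$ be a bounded Lipschitz domain with boundary $\Gamma$ (with surface measure and the Euclidean distance), and let $A^{\alpha\beta}=(A^{\alpha\beta}_{ij})_{i,j=1}^{n+1}$, $1\le\alpha,\beta\le m$, be bounded measurable complex coefficients on $\Omega$ that are elliptic: for some $\lambda>0$, $\operatorname{Re}\sum_{\alpha,\beta,i,j}A^{\alpha\beta}_{ij}(x)\,\xi^\beta_j\,\overline{\xi^\alpha_i}\ge\lambda|\xi|^2$ for almost all $x\in\Omega$ and all $\xi\in\mathbb C^{(n+1)m}$. All functions below are $\mathbb C^m$-valued unless stated otherwise. Put $\mathfrak a(u,v)=\sum_{\alpha,\beta,i,j}\int_\Omega A^{\alpha\beta}_{ij}\,\partial_ju^\beta\,\overline{\partial_iv^\alpha}\,dx$ for $u,v\in W^{1,2}(\Omega)$, let $\mathcal H(\Omega)$ be the set of all $u\in W^{1,2}(\Omega)$ with $\mathfrak a(u,\varphi)=0$ for all $\varphi\in C_0^\infty(\Omega)$, and let $\operatorname{tr}:W^{1,2}(\Omega)\to L^2(\Gamma)$ be the trace operator. The Dirichlet-to-Neumann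 operator $N$ in $L^2(\Gamma)$ is defined by: $f\in D(N)$ and $Nf=g$ if and only if there is $u\in\mathcal H(\Omega)$ with $\operatorname{tr}u=f$ and $\mathfrak a(u,v)=(g\,|\,\operatorname{tr}v)_{L^2(\Gamma)}$ for all $v\in\mathcal H(\Omega)$. The operator $-N$ generates an analytic semigroup $\{e^{-tN}\}$ on $L^2(\Gamma)$. Fix $\omega>0$ such that, for some $\mu>0$, $\operatorname{Re}\mathfrak a(u,u)+\omega\|\operatorname{tr}u\|_2^2\ge\mu\|u\|_{W^{1,2}(\Omega)}^2$ for all $u\in\mathcal H(\Omega)$, put $N_\omega=N+\omega$, and let $\theta\in[0,\pi/2)$ be such that the numerical range of $N_\omega$ lies in $\{0\}\cup\{z\ne0:|\arg z|\le\theta\}$. Then $-N_\omega$ generates an analytic semigroup $\{e^{-zN_\omega}\}$ on the sector $|\arg z|<\pi/2-\theta$. For $\varphi\ge 0$ write $S_\varphi=\{z\in\mathbb C\setminus\{0\}:|\arg z|\le\varphi\}$. **Off-diagonal estimates.** For $p\le q$ in $[1,\infty]$, $\gamma\ge0$ and $U\subseteq\mathbb C\setminus\{0\}$, a family $\{T(z)\}_{z\in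 U}$ of operators on $L^2(\Gamma)$ satisfies $L^p\to L^q$ *off-diagonal estimates of order $\gamma$* with constant $C$ if $$\|\mathbf 1_FT(z)\mathbf 1_Ef\|_q\le C\,(|z|\wedge\operatorname{diam}\Gamma)^{\frac nq-\frac np}\Bigl(1+\frac{\operatorname{dist}(E,F)}{|z|}\Bigr)^{-\gamma}\|\mathbf 1_Ef\|_p$$ for all $z\in U$, $f\in L^p(\Gamma)\cap L^2(\Gamma)$ and measurable $E,F\subseteq\Gamma$. It is *$L^p\to L^q$ bounded* if this holds with $\gamma=0$. **Assumption C (on $L^r$).** There is a constant $K_0$ such that for every Lipschitz function $g:\Gamma\to\mathbb R$, $D(N)$ is invariant under multiplication by $g$, and $\|N(gf)-gNf\|_r\le K_0\operatorname{Lip}(g)\|f\|_r$ for all $f\in D(N)\cap L^r(\Gamma)$, where $\operatorname{Lip}(g)$ is the Lipschitz constant of $g$. **Assumption H (for $p,r,q$).** The family $\{e^{-tN}\}_{t>0}$ is $L^p\to L^r$ bounded with some constant $K_1$ and $L^r\to L^q$ bounded with some constant $K_2$. **Theorem.** Let $p,q,r\in[1,\infty]$ satisfy $$\frac1r+\frac1n>\frac1p\ge\frac1r\ge\frac1q>\frac1r-\frac1n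 .$$ 1. If Assumptions C and H hold, then $\{e^{-tN}\}_{t>0}$ satisfies $L^p\to L^q$ off-diagonal estimates of order $1$, with a constant that depends only on $n,p,q,r,K_0,K_1,K_2$. 2. Let $r=2$ and $\varphi\in[0,\pi/2-\theta)$. If Assumptions C and H hold with $r=2$, then $\{e^{-zN_\omega}\}_{z\in S_\varphi}$ satisfies $L^p\to L^q$ off-diagonal estimates of order $1$, with a constant that depends only on $n,p,q,K_0,K_1,K_2,\varphi,\theta$. -/

import Mathlib

open MeasureTheory Filter Topology
open scoped ENNReal NNReal ContDiff

noncomputable section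

/-! ### Exponents, sectors, distances -/

/-- The real number `1 / p` for `p ∈ [1, ∞]` (with `1 / ∞ = 0`). -/
def recip (p : ℝ≥0∞) : ℝ := (p⁻¹).toReal

/-- The number `1 / r^* = 1 / r - 1 / n`, possibly nonpositive. -/
def recipUpperSobolev (n : ℕ) (r : ℝ≥0∞) : ℝ := recip r - 1 / (n : ℝ)

/-- The number `1 / r_* = 1 / r + 1 / n`. -/
def recipLowerSobolev (n : ℕ) (r : ℝ≥0∞) : ℝ := recip r + 1 / (n : ℝ)

/-- The open sector `{z ≠ 0 : |arg z| < ψ}`. -/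
def openSector (ψ : ℝ) : Set ℂ := {z | z ≠ 0 ∧ |z.arg| < ψ}

/-- The closed sector without its vertex, `{z ≠ 0 : |arg z| ≤ φ}`; for `φ = 0` it is `(0, ∞)`. -/
def sector (φ : ℝ) : Set ℂ := {z | z ≠ 0 ∧ |z.arg| ≤ φ}

/-- The positive half-line `(0, ∞)` as a set of complex numbers. -/
def positiveTimes : Set ℂ := {z | ∃ t : ℝ, 0 < t ∧ z = (t : ℂ)}

/-- The distance `dist(E, F) = inf {d(x, y) : x ∈ E, y ∈ F}` (`∞` if one of the sets is empty). -/
def setDist {X : Type*} [PseudoEMetricSpace X] (E F : Set X) : ℝ≥0∞ :=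
  ⨅ x ∈ E, ⨅ y ∈ F, edist x y

/-! ### Off-diagonal estimates on a metric measure space -/

/-- The function `1_E f` as an element of `L²`. -/
def restrictL2 {X V : Type*} [MeasurableSpace X] [NormedAddCommGroup V] {μ : Measure X}
    {E : Set X} (hE : MeasurableSet E) (f : Lp V 2 μ) : Lp V 2 μ :=
  ((Lp.memLp f).indicator hE).toLp (E.indicator f)

/-- `L^p → L^q` off-diagonal estimates of order `γ` with constant `C` for the family
`{T z}_{z ∈ U}` of operators on `L²(X)`, where `n` is the dimension parameter:
`‖1_F T(z) 1_E f‖_q ≤ C (|z| ∧ diam X)^(n/q - n/p) (1 + dist(E,F)/|z|)^(-γ) ‖1_E f‖_p`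
for all `z ∈ U`, all `f ∈ L^p ∩ L²` and all measurable `E`, `F`. -/
def OffDiagonalEstimates {X V : Type*} [MetricSpace X] [MeasurableSpace X]
    [NormedAddCommGroup V] [NormedSpace ℂ V] (μ : Measure X) (n : ℝ) (U : Set ℂ)
    (T : ℂ → Lp V 2 μ →L[ℂ] Lp V 2 μ) (p q : ℝ≥0∞) (γ : ℝ) (C : ℝ≥0) : Prop :=
  ∀ z ∈ U, ∀ f : Lp V 2 μ, MemLp f p μ →
    ∀ (E F : Set X) (hE : MeasurableSet E), MeasurableSet F →
      eLpNorm (F.indicator (T z (restrictL2 hE f))) q μ ≤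
        (C : ℝ≥0∞) * (min ‖z‖ₑ (Metric.ediam (Set.univ : Set X))) ^ (n * recip q - n * recip p)
          * (1 + setDist E F / ‖z‖ₑ) ^ (-γ) * eLpNorm (E.indicator f) p μ

/-- `L^p → L^q` boundedness of a family of operators: off-diagonal estimates of order `0`. -/
def LpLqBounded {X V : Type*} [MetricSpace X] [MeasurableSpace X]
    [NormedAddCommGroup V] [NormedSpace ℂ V] (μ : Measure X) (n : ℝ) (U : Set ℂ)
    (T : ℂ → Lp V 2 μ →L[ℂ] Lp V 2 μ) (p q : ℝ≥0∞) (C : ℝ≥0) : Prop :=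
  OffDiagonalEstimates μ n U T p q 0 C

/-! ### Analytic semigroups

An operator `A` in a Banach space `H` is represented by its graph
`{(f, h) : f ∈ D(A), A f = h} ⊆ H × H`. -/

/-- `T` is an analytic semigroup on the open sector of half-angle `ψ`, strongly continuous at zero
in every smaller sector, and `-A` is its generator: `f ∈ D(A)` and `A f = h` if and only if
`(f - T(t) f) / t → h` as `t → 0+`. -/
structure IsAnalyticSemigroup {H : Type*} [NormedAddCommGroup H] [NormedSpace ℂ H]
    (ψ : ℝ) (A : Set (H × H)) (T : ℂ → H →L[ℂ] H) : Prop where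
  add : ∀ z ∈ openSector ψ, ∀ w ∈ openSector ψ, T (z + w) = (T z).comp (T w)
  analytic : DifferentiableOn ℂ T (openSector ψ)
  continuous_zero : ∀ ψ' < ψ, ∀ f : H, Tendsto (fun z => T z f) (𝓝[openSector ψ'] 0) (𝓝 f)
  generator : ∀ f h : H, (f, h) ∈ A ↔
    Tendsto (fun t : ℝ => (t : ℂ)⁻¹ • (f - T (t : ℂ) f)) (𝓝[>] 0) (𝓝 h)

open Classical in
/-- The family `{e^{-zA}}`, `|arg z| < ψ`: the analytic semigroup on the open sector of half-angle
`ψ` with generator `-A`. It is determined on that sector by `A`; it is read only for those `z`. (If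
`-A` does not generate an analytic semigroup on the sector, the value is `0`.) -/
def expNegSector {H : Type*} [NormedAddCommGroup H] [NormedSpace ℂ H]
    (ψ : ℝ) (A : Set (H × H)) : ℂ → H →L[ℂ] H :=
  if h : ∃ T : ℂ → H →L[ℂ] H, IsAnalyticSemigroup ψ A T then h.choose else 0

open Classical in
/-- The semigroup `{e^{-tA}}`, `t > 0`, for an operator `-A` that generates an analytic semigroup on
some sector. It is determined by `A` for these `t`; it is read only for positive times. (If `-A`
does not generate an analytic semigroup, the value is `0`.) -/
def expNeg {H : Type*} [NormedAddCommGroup H] [NormedSpace ℂ H]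
    (A : Set (H × H)) : ℂ → H →L[ℂ] H :=
  if h : ∃ ψ : ℝ, (0 < ψ ∧ ψ ≤ Real.pi / 2) ∧ ∃ T : ℂ → H →L[ℂ] H, IsAnalyticSemigroup ψ A T then
    h.choose_spec.2.choose
  else 0

/-- The (graph of the) shifted operator `A + κ`. -/
def shiftGraph {H : Type*} [NormedAddCommGroup H] [NormedSpace ℂ H]
    (A : Set (H × H)) (κ : ℝ) : Set (H × H) :=
  {x | (x.1, x.2 - (κ : ℂ) • x.1) ∈ A}

/-- The numerical range of `A` is contained in the closed sector
`{0} ∪ {z ≠ 0 : |arg z| ≤ θ}` (recall that `arg 0 = 0`). -/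
def NumericalRangeInSector {H : Type*} [NormedAddCommGroup H] [InnerProductSpace ℂ H]
    (A : Set (H × H)) (θ : ℝ) : Prop :=
  ∀ f h : H, (f, h) ∈ A → |(inner ℂ f h : ℂ).arg| ≤ θ

/-! ### Lipschitz domains, Sobolev functions and traces -/

/-- The ambient space `ℝ^{n+1}`. -/
abbrev Space (n : ℕ) : Type := EuclideanSpace ℝ (Fin (n + 1))

/-- The space of values `ℂ^m`. -/
abbrev Val (m : ℕ) : Type := EuclideanSpace ℂ (Fin m)

/-- A bounded Lipschitz domain in `ℝ^{n+1}`: a nonempty, bounded, open and connected set which,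
near each of its boundary points and after a rigid motion, is the set of points lying above the
graph of a Lipschitz function of the first `n` coordinates. -/
structure IsBoundedLipschitzDomain {n : ℕ} (Ω : Set (Space n)) : Prop where
  isOpen : IsOpen Ω
  isConnected : IsConnected Ω
  isBounded : Bornology.IsBounded Ω
  lipschitz : ∀ x ∈ frontier Ω, ∃ W : Set (Space n), IsOpen W ∧ x ∈ W ∧
    ∃ (e : Space n ≃ᵃⁱ[ℝ] Space n) (K : ℝ≥0) (h : EuclideanSpace ℝ (Fin n) → ℝ),
      LipschitzWith K h ∧
        ∀ y ∈ W, (y ∈ Ω ↔ h (WithLp.toLp 2 fun i => e y i.castSucc) < e y (Fin.last n))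

/-- Lebesgue measure on `Ω`. -/
abbrev interiorMeasure {n : ℕ} (Ω : Set (Space n)) : Measure (Space n) := volume.restrict Ω

/-- The surface measure on the boundary `Γ` of `Ω`: the `n`-dimensional Hausdorff measure,
normalized so as to agree with Lebesgue measure on `ℝ^n`. -/
def surfaceMeasure {n : ℕ} (Ω : Set (Space n)) : Measure (frontier Ω) :=
  Measure.euclideanHausdorffMeasure n

/-- The space `L²(Ω; ℂ^m)`. -/
abbrev L2Int {n : ℕ} (m : ℕ) (Ω : Set (Space n)) : Type := Lp (Val m) 2 (interiorMeasure Ω)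

/-- The space `L²(Γ; ℂ^m)`, where `Γ` is the boundary of `Ω`. -/
abbrev L2Bdry {n : ℕ} (m : ℕ) (Ω : Set (Space n)) : Type := Lp (Val m) 2 (surfaceMeasure Ω)

/-- The classical partial derivative `∂_j φ`. -/
def partialDeriv {n : ℕ} {V : Type*} [NormedAddCommGroup V] [NormedSpace ℝ V]
    (φ : Space n → V) (j : Fin (n + 1)) (x : Space n) : V :=
  fderiv ℝ φ x (EuclideanSpace.single j 1)

/-- Functions in `L²(Ω; ℂ^m)` together with candidates for their `n + 1` partial derivatives. -/
abbrev Jet {n : ℕ} (m : ℕ) (Ω : Set (Space n)) : Type := L2Int m Ω × (Fin (n + 1) → L2Int m Ω)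

/-- `φ ∈ C_0^∞(Ω; V)`. -/
def IsTestFunction {n : ℕ} {V : Type*} [NormedAddCommGroup V] [NormedSpace ℝ V]
    (Ω : Set (Space n)) (φ : Space n → V) : Prop :=
  ContDiff ℝ ∞ φ ∧ HasCompactSupport φ ∧ tsupport φ ⊆ Ω

/-- The Sobolev space `W^{1,2}(Ω; ℂ^m)`; its elements are the pairs `(u, (∂_1 u, …, ∂_{n+1} u))`
with `u ∈ L²` whose weak partial derivatives `∂_j u` belong to `L²`. -/
def sobolevW12 {n : ℕ} (m : ℕ) (Ω : Set (Space n)) : Set (Jet m Ω) :=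
  {u | ∀ φ : Space n → ℝ, IsTestFunction Ω φ → ∀ j : Fin (n + 1),
    ∫ x in Ω, partialDeriv φ j x • u.1 x = - ∫ x in Ω, φ x • u.2 j x}

/-- The square of the norm of `W^{1,2}(Ω; ℂ^m)`. -/
def sobolevNormSq {n m : ℕ} {Ω : Set (Space n)} (u : Jet m Ω) : ℝ :=
  ‖u.1‖ ^ 2 + ∑ j, ‖u.2 j‖ ^ 2

/-- The graph of the trace operator `W^{1,2}(Ω; ℂ^m) → L²(Γ; ℂ^m)`: the closure of the graph of the
restriction map `φ ↦ φ|_Γ` on `C_0^∞(ℝ^{n+1}; ℂ^m)`. Thus `(u, f)` belongs to it if and only if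
`u ∈ W^{1,2}` and `tr u = f`; the range of `tr` is the trace space `H^{1/2}(Γ; ℂ^m)`. -/
def traceGraph {n : ℕ} (m : ℕ) (Ω : Set (Space n)) : Set (Jet m Ω × L2Bdry m Ω) :=
  closure {x | ∃ φ : Space n → Val m, ContDiff ℝ ∞ φ ∧ HasCompactSupport φ ∧
    x.1.1 =ᵐ[interiorMeasure Ω] φ ∧
    (∀ j, x.1.2 j =ᵐ[interiorMeasure Ω] partialDeriv φ j) ∧
    x.2 =ᵐ[surfaceMeasure Ω] fun y => φ y}

/-! ### Elliptic systems and the Dirichlet-to-Neumann operator -/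

/-- Coefficients `A^{αβ}_{ij}(x)` of a system of size `m` in `ℝ^{n+1}`, as `A α β x i j`. -/
abbrev Coeff (n m : ℕ) : Type :=
  Fin m → Fin m → Space n → Matrix (Fin (n + 1)) (Fin (n + 1)) ℂ

/-- The coefficients are bounded, measurable and elliptic on `Ω`. -/
structure IsElliptic {n m : ℕ} (Ω : Set (Space n)) (A : Coeff n m) : Prop where
  measurable : ∀ α β i j, AEStronglyMeasurable (fun x => A α β x i j) (interiorMeasure Ω)
  bounded : ∃ M : ℝ, ∀ᵐ x ∂(interiorMeasure Ω), ∀ α β i j, ‖A α β x i j‖ ≤ M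
  elliptic : ∃ c : ℝ, 0 < c ∧ ∀ᵐ x ∂(interiorMeasure Ω), ∀ ξ : Fin m → Fin (n + 1) → ℂ,
    c * ∑ α, ∑ i, ‖ξ α i‖ ^ 2 ≤
      (∑ α, ∑ β, ∑ i, ∑ j, A α β x i j * ξ β j * star (ξ α i)).re

/-- The sesquilinear form `𝔞(u, v) = ∑_{α,β,i,j} ∫_Ω A^{αβ}_{ij} ∂_j u^β conj(∂_i v^α)`, as a
function of the gradients `Du = (∂_j u)_j` and `Dv = (∂_i v)_i`. -/
def sesqForm {n m : ℕ} (Ω : Set (Space n)) (A : Coeff n m)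
    (Du Dv : Fin (n + 1) → Space n → Val m) : ℂ :=
  ∑ α, ∑ β, ∑ i, ∑ j, ∫ x in Ω, A α β x i j * Du j x β * star (Dv i x α)

/-- The space `ℋ(Ω)` of harmonic functions: all `u ∈ W^{1,2}(Ω; ℂ^m)` such that `𝔞(u, φ) = 0` for
every `φ ∈ C_0^∞(Ω; ℂ^m)`. -/
def harmonicSpace {n m : ℕ} (Ω : Set (Space n)) (A : Coeff n m) : Set (Jet m Ω) :=
  {u | u ∈ sobolevW12 m Ω ∧ ∀ φ : Space n → Val m, IsTestFunction Ω φ →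
    sesqForm Ω A (fun j => u.2 j) (fun j => partialDeriv φ j) = 0}

/-- The (graph of the) Dirichlet-to-Neumann operator `N` in `L²(Γ; ℂ^m)`: `f ∈ D(N)` and `N f = g`
if and only if `f = tr u` for some `u ∈ ℋ(Ω)` (the harmonic lifting of `f`) such that
`𝔞(u, v) = (g | tr v)` for all `v ∈ ℋ(Ω)`. -/
def dirichletToNeumann {n m : ℕ} (Ω : Set (Space n)) (A : Coeff n m) :
    Set (L2Bdry m Ω × L2Bdry m Ω) :=
  {x | ∃ u ∈ harmonicSpace Ω A, (u, x.1) ∈ traceGraph m Ω ∧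
    ∀ v ∈ harmonicSpace Ω A, ∀ h : L2Bdry m Ω, (v, h) ∈ traceGraph m Ω →
      sesqForm Ω A (fun j => u.2 j) (fun j => v.2 j) = inner ℂ h x.2}

/-- `κ` is an admissible shift: `κ > 0` and
`Re 𝔞(u, u) + κ ‖tr u‖₂² ≥ μ ‖u‖²_{W^{1,2}}` on `ℋ(Ω)` for some `μ > 0`. -/
def IsAdmissibleShift {n m : ℕ} (Ω : Set (Space n)) (A : Coeff n m) (κ : ℝ) : Prop :=
  0 < κ ∧ ∃ μ : ℝ, 0 < μ ∧ ∀ u ∈ harmonicSpace Ω A, ∀ f : L2Bdry m Ω, (u, f) ∈ traceGraph m Ω →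
    μ * sobolevNormSq u ≤
      (sesqForm Ω A (fun j => u.2 j) (fun j => u.2 j)).re + κ * ‖f‖ ^ 2

/-- The commutator assumption on `L^r(Γ)` with constant `C` for an operator `N` in `L²(Γ; ℂ^m)`: for
every Lipschitz function `g` on `Γ`, multiplication by `g` maps `D(N)` to itself, and
`‖N (g f) - g N f‖_r ≤ C Lip(g) ‖f‖_r` for all `f ∈ D(N) ∩ L^r`. -/
def CommutatorBound {n m : ℕ} {Ω : Set (Space n)} (N : Set (L2Bdry m Ω × L2Bdry m Ω))
    (r : ℝ≥0∞) (C : ℝ≥0) : Prop :=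
  ∀ (g : frontier Ω → ℝ) (K : ℝ≥0), LipschitzWith K g →
    (∀ f h : L2Bdry m Ω, (f, h) ∈ N → ∃ f' h' : L2Bdry m Ω, (f', h') ∈ N ∧
      f' =ᵐ[surfaceMeasure Ω] fun x => (g x : ℂ) • f x) ∧
    (∀ f h f' h' : L2Bdry m Ω, (f, h) ∈ N → (f', h') ∈ N →
      f' =ᵐ[surfaceMeasure Ω] (fun x => (g x : ℂ) • f x) →
      MemLp f r (surfaceMeasure Ω) →
      eLpNorm (fun x => h' x - (g x : ℂ) • h x) r (surfaceMeasure Ω) ≤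
        (C : ℝ≥0∞) * (K : ℝ≥0∞) * eLpNorm f r (surfaceMeasure Ω))

end

/-!
The off-diagonal factor comes from one commutator. For sets `E`, `F` at distance `d > 0` let
`g = min (dist(·, E)) d`, a Lipschitz function with constant one that is `0` on `E` and `d` on `F`.
Then `d 1_F T(z) 1_E = 1_F [g, T(z)] 1_E` (`ofReal_mul_eLpNorm_indicator_le`), and along a ray
`z = t ζ`, `|ζ| = 1`, the derivative of `s ↦ T((t - s) ζ) g T(s ζ) f` is
`ζ T((t - s) ζ) [A, g] T(s ζ) f`. The three factors map `L^p → L^r → L^r → L^q` with norms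
`(s ∧ D)^{-a}`, `K₀` and `((t - s) ∧ D)^{-b}` up to constants, where `D = diam Γ`,
`a = n/p - n/r` and `b = n/r - n/q`. The conditions on `p`, `q`, `r` say that `0 ≤ a, b < 1`, so
that the singularities at both ends are integrable; since `s ∧ D ≥ (s / t) (t ∧ D)`, the commutator is
bounded from `L^p` to `L^q` by a constant times `t (t ∧ D)^{-a-b}` (`eLpNorm_commutator_le`).
Dividing by `d` gives the decay `t / d` for `d > t`, and for `d ≤ t` the `L^p → L^q` bound from
`T(z) = T(z/2) T(z/2)` suffices (`offDiagonal_ray`).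

The `L^q` norm of the integral over `s` is estimated without integration: balls of `L^q` are closed
and convex in `L²`, so a mean value inequality in `L²` with an explicit scalar majorant applies
(`extendedSeminorm_sub_le`).

For complex times, `N_ω` has the same commutators as `N`. The `L^p → L²` and `L² → L^q` bounds on
the closed sector follow from those on the half-line by writing `z = (z - δ |z|) + δ |z|` with a small
`δ` that depends on the angles only (`exists_sub_norm_mem_openSector`), because the semigroup is
contractive on `L²` in the open sector (`IsAnalyticSemigroup.norm_apply_le`) and `e^{-t N_ω}`
equals `e^{-ω t} e^{-t N}` by uniqueness of the semigroup of a generator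
(`IsAnalyticSemigroup.eq_of_pos`).
-/

/-! ### Sectors -/

lemma isOpen_openSector {ψ : ℝ} (hψ : ψ ≤ Real.pi / 2) : IsOpen (openSector ψ) := by
  have h : openSector ψ = Complex.slitPlane ∩ (fun z => |z.arg|) ⁻¹' Set.Iio ψ := by
    ext z
    simp only [openSector, Set.mem_ofPred_eq, Set.mem_inter_iff, Set.mem_preimage, Set.mem_Iio,
      Complex.mem_slitPlane_iff_arg]
    constructor
    · rintro ⟨h0, hz⟩
      refine ⟨⟨fun h => ?_, h0⟩, hz⟩
      rw [h, abs_of_pos Real.pi_pos] at hz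
      linarith [Real.pi_pos]
    · rintro ⟨⟨-, h0⟩, hz⟩
      exact ⟨h0, hz⟩
  rw [h]
  refine ContinuousOn.isOpen_inter_preimage (fun z hz => ?_) Complex.isOpen_slitPlane isOpen_Iio
  exact (Complex.continuousAt_arg hz).abs.continuousWithinAt

lemma ofReal_mul_mem_openSector {ψ : ℝ} {ζ : ℂ} (hζ : ζ ∈ openSector ψ) {s : ℝ} (hs : 0 < s) :
    (s : ℂ) * ζ ∈ openSector ψ := by
  refine ⟨mul_ne_zero (by exact_mod_cast hs.ne') hζ.1, ?_⟩
  rw [Complex.arg_real_mul _ hs]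
  exact hζ.2

lemma ofReal_mem_openSector {ψ : ℝ} (hψ : 0 < ψ) {s : ℝ} (hs : 0 < s) :
    (s : ℂ) ∈ openSector ψ := by
  refine ⟨by exact_mod_cast hs.ne', ?_⟩
  rwa [Complex.arg_ofReal_of_nonneg hs.le, abs_zero]

/-- The directions of a closed sector keep a positive distance from the complement of a larger open
sector, so a fixed multiple of `|z|` can be split off from every `z` of the smaller one. -/
lemma exists_sub_norm_mem_openSector {φ ψ : ℝ} (hφψ : φ < ψ) (hψ : ψ ≤ Real.pi / 2) :
    ∃ δ : ℝ, 0 < δ ∧ δ ≤ 1 ∧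
      ∀ z ∈ sector φ, z - ((δ * ‖z‖ : ℝ) : ℂ) ∈ openSector ψ := by
  set K : Set ℂ := (fun α : ℝ => Complex.exp (α * Complex.I)) '' Set.Icc (-φ) φ with hK
  have hKc : IsCompact K := isCompact_Icc.image (by fun_prop)
  have hKs : K ⊆ openSector ψ := by
    rintro _ ⟨α, hα, rfl⟩
    have h1 : |α| ≤ φ := abs_le.2 hα
    have h2 := abs_lt.1 (h1.trans_lt (hφψ.trans_le hψ))
    refine ⟨Complex.exp_ne_zero _, ?_⟩
    rw [Complex.arg_exp_mul_I, toIocMod_eq_self _ |>.2]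
    · exact h1.trans_lt hφψ
    · constructor <;> linarith [Real.pi_pos]
  obtain ⟨δ, hδ, hsub⟩ := hKc.exists_cthickening_subset_open (isOpen_openSector hψ) hKs
  refine ⟨min δ 1, lt_min hδ one_pos, min_le_right _ _, fun z hz => ?_⟩
  have hz0 : 0 < ‖z‖ := norm_pos_iff.2 hz.1
  have hmem : Complex.exp (z.arg * Complex.I) - ((min δ 1 : ℝ) : ℂ) ∈ openSector ψ := by
    refine hsub (Metric.mem_cthickening_of_dist_le _ _ δ K ⟨z.arg, abs_le.1 hz.2, rfl⟩ ?_)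
    rw [dist_eq_norm, sub_sub_cancel_left, norm_neg, Complex.norm_real, Real.norm_eq_abs,
      abs_of_pos (lt_min hδ one_pos)]
    exact min_le_left _ _
  have := ofReal_mul_mem_openSector hmem hz0
  rwa [mul_sub, Complex.norm_mul_exp_arg_mul_I, ← Complex.ofReal_mul, mul_comm ‖z‖] at this

/-! ### Analytic semigroups and their generators -/

namespace IsAnalyticSemigroup

variable {H : Type*} [NormedAddCommGroup H] [NormedSpace ℂ H] {ψ : ℝ} {A : Set (H × H)}
  {T : ℂ → H →L[ℂ] H}

lemma hasDerivAt (hT : IsAnalyticSemigroup ψ A T) (hψ : ψ ≤ Real.pi / 2) {z : ℂ}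
    (hz : z ∈ openSector ψ) : HasDerivAt T (deriv T z) z :=
  (hT.analytic.differentiableAt ((isOpen_openSector hψ).mem_nhds hz)).hasDerivAt

/-- Strong continuity at zero along a ray. -/
lemma tendsto_ray (hT : IsAnalyticSemigroup ψ A T) {ζ : ℂ} (hζ : ζ ∈ openSector ψ) (f : H) :
    Tendsto (fun s : ℝ => T (s * ζ) f) (𝓝[>] 0) (𝓝 f) := by
  obtain ⟨ψ', h1, h2⟩ := exists_between hζ.2
  refine (hT.continuous_zero ψ' h2 f).comp (tendsto_nhdsWithin_iff.2 ⟨?_, ?_⟩)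
  · have : Continuous fun s : ℝ => (s : ℂ) * ζ := by fun_prop
    simpa using (this.tendsto 0).mono_left nhdsWithin_le_nhds
  · filter_upwards [self_mem_nhdsWithin] with s hs
    exact ofReal_mul_mem_openSector ⟨hζ.1, h1⟩ hs

lemma tendsto_pos (hT : IsAnalyticSemigroup ψ A T) (hψ0 : 0 < ψ) (f : H) :
    Tendsto (fun s : ℝ => T s f) (𝓝[>] 0) (𝓝 f) := by
  simpa using hT.tendsto_ray (ζ := 1) (by simpa using ofReal_mem_openSector hψ0 one_pos) f

/-- The semigroup regularizes: `T z f ∈ D(A)` and `A (T z f) = - T'(z) f`. -/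
lemma mem_generator (hT : IsAnalyticSemigroup ψ A T) (hψ0 : 0 < ψ) (hψ : ψ ≤ Real.pi / 2) {z : ℂ}
    (hz : z ∈ openSector ψ) (f : H) : (T z f, -deriv T z f) ∈ A := by
  rw [hT.generator]
  have h1 : HasDerivAt (fun s : ℝ => T (z + s) f) (deriv T z f) 0 := by
    have h0 : HasDerivAt T (deriv T z) (z + ((0 : ℝ) : ℂ)) := by simpa using hT.hasDerivAt hψ hz
    have h2 : HasDerivAt (fun s : ℝ => T (z + s)) (deriv T z) 0 := by
      simpa [Function.comp_def] using
        h0.scomp (0 : ℝ) ((Complex.ofRealCLM.hasDerivAt (x := (0 : ℝ))).const_add z)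
    exact ((ContinuousLinearMap.apply ℂ H f).restrictScalars ℝ).hasFDerivAt.comp_hasDerivAt 0 h2
  have h3 := h1.tendsto_slope_zero_right.neg
  refine h3.congr' ?_
  filter_upwards [self_mem_nhdsWithin] with t ht
  rw [zero_add, Complex.ofReal_zero, add_zero, ← smul_neg, neg_sub, add_comm z,
    hT.add _ (ofReal_mem_openSector hψ0 ht) z hz, ContinuousLinearMap.comp_apply,
    ← Complex.coe_smul, Complex.ofReal_inv]

/-- On the domain of the generator `T'(z) f = - T(z) A f`. -/
lemma deriv_apply (hT : IsAnalyticSemigroup ψ A T) (hψ0 : 0 < ψ) (hψ : ψ ≤ Real.pi / 2) {z : ℂ}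
    (hz : z ∈ openSector ψ) {f h : H} (hf : (f, h) ∈ A) : deriv T z f = -T z h := by
  have h1 := (hT.generator _ _).1 (hT.mem_generator hψ0 hψ hz f)
  have h2 := ((T z).continuous.tendsto h).comp ((hT.generator _ _).1 hf)
  have h3 : -deriv T z f = T z h := by
    refine tendsto_nhds_unique h1 (h2.congr' ?_)
    filter_upwards [self_mem_nhdsWithin] with t ht
    have hc : T t (T z f) = T z (T t f) := by
      have ht' := ofReal_mem_openSector hψ0 ht
      rw [← ContinuousLinearMap.comp_apply, ← ContinuousLinearMap.comp_apply, ← hT.add _ ht' _ hz,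
        ← hT.add _ hz _ ht', add_comm]
    simp only [Function.comp_apply, map_smul, map_sub, hc]
  rw [← h3, neg_neg]

lemma hasDerivAt_ray (hT : IsAnalyticSemigroup ψ A T) (hψ : ψ ≤ Real.pi / 2) {ζ : ℂ}
    (hζ : ζ ∈ openSector ψ) {s : ℝ} (hs : 0 < s) :
    HasDerivAt (fun s : ℝ => T (s * ζ)) (ζ • deriv T (s * ζ)) s := by
  have h1 := hT.hasDerivAt hψ (ofReal_mul_mem_openSector hζ hs)
  have h2 : HasDerivAt (fun s : ℝ => (s : ℂ) * ζ) ζ s := by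
    simpa using (Complex.ofRealCLM.hasDerivAt (x := s)).mul_const ζ
  exact h1.scomp s h2

/-- A product rule: the derivative of `s ↦ T((t - s) ζ) M S(s ζ) f`. -/
lemma hasDerivAt_conj {ψ' : ℝ} {B : Set (H × H)} {S : ℂ → H →L[ℂ] H}
    (hT : IsAnalyticSemigroup ψ A T) (hS : IsAnalyticSemigroup ψ' B S) (hψ : ψ ≤ Real.pi / 2)
    (hψ' : ψ' ≤ Real.pi / 2) {ζ : ℂ} (hζ : ζ ∈ openSector ψ) (hζ' : ζ ∈ openSector ψ')
    (M : H →L[ℂ] H) (f : H) {t s : ℝ} (hs : 0 < s) (hst : s < t) :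
    HasDerivAt (fun s : ℝ => T ((t - s : ℝ) * ζ) (M (S (s * ζ) f)))
      (ζ • (T ((t - s : ℝ) * ζ) (M (deriv S (s * ζ) f)) -
        deriv T ((t - s : ℝ) * ζ) (M (S (s * ζ) f)))) s := by
  have h1 : HasDerivAt (fun s : ℝ => T ((t - s : ℝ) * ζ))
      (-(ζ • deriv T ((t - s : ℝ) * ζ))) s := by
    simpa [Function.comp_def] using
      (hT.hasDerivAt_ray hψ hζ (sub_pos.2 hst)).scomp s ((hasDerivAt_id s).const_sub t)
  have h2 : HasDerivAt (fun s : ℝ => M (S (s * ζ) f)) (M ((ζ • deriv S (s * ζ)) f)) s := by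
    have := ((ContinuousLinearMap.apply ℂ H f).restrictScalars ℝ).hasFDerivAt.comp_hasDerivAt s
      (hS.hasDerivAt_ray hψ' hζ' hs)
    exact (M.restrictScalars ℝ).hasFDerivAt.comp_hasDerivAt s this
  have h3 := ((ContinuousLinearMap.restrictScalarsL ℂ H H ℝ ℝ).hasFDerivAt.comp_hasDerivAt s
    h1).clm_apply h2
  refine h3.congr_deriv ?_
  simp [smul_sub]
  abel

/-- A semigroup is determined on the positive half-line by its generator. -/
lemma eq_of_pos {ψ' : ℝ} {S : ℂ → H →L[ℂ] H} (hT : IsAnalyticSemigroup ψ A T)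
    (hS : IsAnalyticSemigroup ψ' A S) (hψ0 : 0 < ψ) (hψ : ψ ≤ Real.pi / 2) (hψ0' : 0 < ψ')
    (hψ' : ψ' ≤ Real.pi / 2) {t : ℝ} (ht : 0 < t) : T t = S t := by
  have h1 : (1 : ℂ) ∈ openSector ψ := by simpa using ofReal_mem_openSector hψ0 one_pos
  have h1' : (1 : ℂ) ∈ openSector ψ' := by simpa using ofReal_mem_openSector hψ0' one_pos
  ext f
  -- `s ↦ T(t - s) S(s) f` is constant on every interval `(0, t)`
  have hconst : ∀ t : ℝ, ∀ a ∈ Set.Ioo 0 t, ∀ b ∈ Set.Ioo 0 t,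
      T ((t - a : ℝ) : ℂ) (S (a : ℂ) f) = T ((t - b : ℝ) : ℂ) (S (b : ℂ) f) := by
    intro t a ha b hb
    have hd : ∀ s ∈ Set.Ioo 0 t,
        HasDerivAt (fun s : ℝ => T ((t - s : ℝ) : ℂ) (S (s : ℂ) f)) 0 s := by
      intro s hs
      have := hasDerivAt_conj hT hS hψ hψ' h1 h1' (ContinuousLinearMap.id ℂ H) f hs.1 hs.2
      simp only [mul_one, ContinuousLinearMap.id_apply, one_smul] at this
      refine this.congr_deriv ?_
      rw [hT.deriv_apply hψ0 hψ (ofReal_mem_openSector hψ0 (sub_pos.2 hs.2))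
        (hS.mem_generator hψ0' hψ' (ofReal_mem_openSector hψ0' hs.1) f)]
      simp
    exact isOpen_Ioo.is_const_of_deriv_eq_zero isPreconnected_Ioo
      (fun s hs => (hd s hs).differentiableAt.differentiableWithinAt)
      (fun s hs => (hd s hs).deriv) ha hb
  have hT_cont : ∀ s : ℝ, 0 < s → ContinuousAt (fun s : ℝ => T (s : ℂ)) s := by
    intro s hs
    simpa using (hT.hasDerivAt_ray hψ h1 hs).continuousAt
  -- letting `b → 0` in `T(a) S(b) f = T(a + b - b') S(b') f`
  have hab : ∀ a b : ℝ, 0 < a → 0 < b → T (a : ℂ) (S (b : ℂ) f) = T ((a + b : ℝ) : ℂ) f := by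
    intro a b ha hb
    have hl : Tendsto (fun c : ℝ => T ((a + b - c : ℝ) : ℂ) (S (c : ℂ) f)) (𝓝[>] 0)
        (𝓝 (T ((a + b : ℝ) : ℂ) f)) := by
      have hc : Tendsto (fun c : ℝ => T ((a + b - c : ℝ) : ℂ)) (𝓝[>] 0)
          (𝓝 (T ((a + b : ℝ) : ℂ))) := by
        refine (hT_cont _ (add_pos ha hb)).tendsto.comp ?_
        have : Continuous fun c : ℝ => a + b - c := by fun_prop
        simpa using (this.tendsto 0).mono_left nhdsWithin_le_nhds
      exact (isBoundedBilinearMap_apply.continuous.tendsto _).comp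
        (hc.prodMk_nhds (hS.tendsto_pos hψ0' f))
    refine tendsto_nhds_unique (tendsto_const_nhds.congr' ?_) hl
    filter_upwards [Ioo_mem_nhdsGT hb] with c hc
    have := hconst (a + b) b ⟨hb, by linarith⟩ c ⟨hc.1, by linarith [hc.2]⟩
    rwa [add_sub_cancel_right] at this
  -- letting `a → 0`
  have hr : Tendsto (fun a : ℝ => T ((a + t : ℝ) : ℂ) f) (𝓝[>] 0) (𝓝 (T (t : ℂ) f)) := by
    have hc : Tendsto (fun a : ℝ => T ((a + t : ℝ) : ℂ)) (𝓝[>] 0) (𝓝 (T (t : ℂ))) := by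
      refine (hT_cont t ht).tendsto.comp ?_
      have : Continuous fun c : ℝ => c + t := by fun_prop
      simpa using (this.tendsto 0).mono_left nhdsWithin_le_nhds
    exact (isBoundedBilinearMap_apply.continuous.tendsto (T (t : ℂ), f)).comp
      (hc.prodMk_nhds tendsto_const_nhds)
  refine tendsto_nhds_unique (hr.congr' ?_) (hT.tendsto_pos hψ0 (S (t : ℂ) f))
  filter_upwards [self_mem_nhdsWithin] with a ha
  exact (hab a t ha ht).symm

/-- Undoing a shift of the generator: if `-(A + κ)` generates `T`, then `-A` generates
`e^{κ z} T(z)`. -/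
lemma exp_smul {κ : ℝ} (hT : IsAnalyticSemigroup ψ (shiftGraph A κ) T) (hψ0 : 0 < ψ) :
    IsAnalyticSemigroup ψ A (fun z => Complex.exp (κ * z) • T z) where
  add z hz w hw := by
    rw [hT.add z hz w hw, mul_add, Complex.exp_add]
    ext f
    simp [mul_smul, smul_comm (Complex.exp (κ * z))]
  analytic := by
    refine DifferentiableOn.fun_smul ?_ hT.analytic
    exact (Complex.differentiable_exp.comp (differentiable_id.const_mul _)).differentiableOn
  continuous_zero ψ' hψ' f := by
    have h1 : Tendsto (fun z : ℂ => Complex.exp (κ * z)) (𝓝[openSector ψ'] 0) (𝓝 1) := by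
      have : Continuous fun z : ℂ => Complex.exp (κ * z) := by fun_prop
      simpa using (this.tendsto 0).mono_left nhdsWithin_le_nhds
    simpa using h1.smul (hT.continuous_zero ψ' hψ' f)
  generator f h := by
    have h0 : (f, h) ∈ A ↔ (f, h + (κ : ℂ) • f) ∈ shiftGraph A κ := by simp [shiftGraph]
    have h1 : HasDerivAt (fun t : ℝ => Complex.exp (κ * t)) κ 0 := by
      have h2 : HasDerivAt (fun t : ℝ => (κ : ℂ) * t) κ 0 := by
        simpa using (Complex.ofRealCLM.hasDerivAt (x := (0 : ℝ))).const_mul (κ : ℂ)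
      simpa using h2.cexp
    -- the two difference quotients differ by `(e^{κ t} - 1) / t · T(t) f → κ f`
    have h3 : Tendsto (fun t : ℝ => ((t : ℂ)⁻¹ * (Complex.exp (κ * t) - 1)) • T t f) (𝓝[>] 0)
        (𝓝 ((κ : ℂ) • f)) := by
      refine Tendsto.smul (h1.tendsto_slope_zero_right.congr fun t => ?_) (hT.tendsto_pos hψ0 f)
      simp
    have key : ∀ t : ℝ, (t : ℂ)⁻¹ • (f - (Complex.exp (κ * t) • T (t : ℂ)) f) =
        (t : ℂ)⁻¹ • (f - T (t : ℂ) f) - ((t : ℂ)⁻¹ * (Complex.exp (κ * t) - 1)) • T t f := by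
      intro t
      rw [mul_smul, ← smul_sub, smul_apply, sub_smul, one_smul]
      congr 1
      abel
    rw [h0, hT.generator]
    simp only [key]
    constructor
    · intro h4
      simpa using h4.sub h3
    · intro h4
      simpa using h4.add h3

/-- If the numerical range of `A` lies in the sector of half-angle `θ`, then the semigroup is
contractive on the open sector of half-angle `π / 2 - θ`: there `Re (ζ ⟨f, A f⟩) ≥ 0`, so
`s ↦ ‖T(s ζ) f‖²` decreases. -/
lemma norm_apply_le {H : Type*} [NormedAddCommGroup H] [InnerProductSpace ℂ H] {A : Set (H × H)}
    {T : ℂ → H →L[ℂ] H} {θ : ℝ} (hT : IsAnalyticSemigroup (Real.pi / 2 - θ) A T)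
    (hA : NumericalRangeInSector A θ) (hθ0 : 0 ≤ θ) (hθ : θ < Real.pi / 2) {ζ : ℂ}
    (hζ : ζ ∈ openSector (Real.pi / 2 - θ)) (f : H) : ‖T ζ f‖ ≤ ‖f‖ := by
  have hψ0 : 0 < Real.pi / 2 - θ := by linarith
  have hψ : Real.pi / 2 - θ ≤ Real.pi / 2 := by linarith
  have hd : ∀ s : ℝ, 0 < s → HasDerivAt (fun s : ℝ => T (s * ζ) f) (ζ • deriv T (s * ζ) f) s :=
    fun s hs => ((ContinuousLinearMap.apply ℂ H f).restrictScalars ℝ).hasFDerivAt.comp_hasDerivAt s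
      (hT.hasDerivAt_ray hψ hζ hs)
  have hre : ∀ w : ℂ, |w.arg| ≤ θ → 0 ≤ (ζ * w).re := by
    intro w hw
    have h1 := abs_lt.1 hζ.2
    have h2 := abs_le.1 hw
    have hprod : ζ * w = ((‖ζ‖ * ‖w‖ : ℝ) : ℂ) * Complex.exp ((ζ.arg + w.arg : ℝ) * Complex.I) := by
      conv_lhs => rw [← Complex.norm_mul_exp_arg_mul_I ζ, ← Complex.norm_mul_exp_arg_mul_I w]
      push_cast
      rw [add_mul, Complex.exp_add]
      ring
    rw [hprod, Complex.re_ofReal_mul, Complex.exp_ofReal_mul_I_re]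
    exact mul_nonneg (by positivity)
      (Real.cos_nonneg_of_neg_pi_div_two_le_of_le (by linarith) (by linarith))
  let _ : InnerProductSpace ℝ H := InnerProductSpace.rclikeToReal ℂ H
  have hsq : ∀ s : ℝ, 0 < s → HasDerivAt (fun s : ℝ => ‖T (s * ζ) f‖ ^ 2)
      (2 * inner ℝ (T (s * ζ) f) (ζ • deriv T (s * ζ) f)) s := fun s hs => (hd s hs).norm_sq
  have hneg : ∀ s : ℝ, 0 < s → 2 * inner ℝ (T (s * ζ) f) (ζ • deriv T (s * ζ) f) ≤ 0 := by
    intro s hs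
    have h1 := hre _ (hA _ _ (hT.mem_generator hψ0 hψ (ofReal_mul_mem_openSector hζ hs) f))
    rw [inner_neg_right, mul_neg, Complex.neg_re] at h1
    rw [real_inner_eq_re_inner ℂ, inner_smul_right]
    change 2 * (_ : ℂ).re ≤ 0
    linarith
  have hanti : AntitoneOn (fun s : ℝ => ‖T (s * ζ) f‖ ^ 2) (Set.Ioi 0) := by
    refine antitoneOn_of_deriv_nonpos (convex_Ioi 0)
      (fun s hs => (hsq s hs).continuousAt.continuousWithinAt) ?_ ?_
    · rw [interior_Ioi]
      exact fun s hs => (hsq s hs).differentiableAt.differentiableWithinAt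
    · rw [interior_Ioi]
      intro s hs
      rw [(hsq s hs).deriv]
      exact hneg s hs
  have hlim : Tendsto (fun s : ℝ => ‖T (s * ζ) f‖ ^ 2) (𝓝[>] 0) (𝓝 (‖f‖ ^ 2)) :=
    (hT.tendsto_ray hζ f).norm.pow 2
  have h2 : ‖T ζ f‖ ^ 2 ≤ ‖f‖ ^ 2 := by
    refine ge_of_tendsto hlim ?_
    filter_upwards [Ioo_mem_nhdsGT one_pos] with s hs
    simpa using hanti hs.1 (Set.mem_Ioi.2 one_pos) hs.2.le
  exact (sq_le_sq₀ (norm_nonneg _) (norm_nonneg _)).1 h2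

end IsAnalyticSemigroup

/-! ### A mean value theorem with values in a closed convex set -/

/-- If `G'(s) = w'(s) x` with `w' ≥ 0` and some `x` in the closed convex set `B` (depending on `s`),
then `G(b) - G(a)` is `w(b) - w(a)` times an element of `B`. By the Hahn-Banach theorem this
reduces to monotonicity of real-valued functions. -/
lemma exists_mem_sub_eq_smul {E : Type*} [NormedAddCommGroup E] [NormedSpace ℝ E] {B : Set E}
    (hBc : Convex ℝ B) (hBcl : IsClosed B) {G G' : ℝ → E} {w w' : ℝ → ℝ} {a b : ℝ}
    (hab : a ≤ b) (hw_lt : w a < w b)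
    (hG : ∀ s ∈ Set.Icc a b, HasDerivAt G (G' s) s)
    (hw : ∀ s ∈ Set.Icc a b, HasDerivAt w (w' s) s)
    (hw' : ∀ s ∈ Set.Icc a b, 0 ≤ w' s)
    (hGw : ∀ s ∈ Set.Icc a b, ∃ x ∈ B, G' s = w' s • x) :
    ∃ x ∈ B, G b - G a = (w b - w a) • x := by
  have hpos : 0 < w b - w a := sub_pos.2 hw_lt
  refine ⟨(w b - w a)⁻¹ • (G b - G a), ?_, (smul_inv_smul₀ hpos.ne' _).symm⟩
  by_contra hx
  obtain ⟨l, u, hl, hu⟩ := geometric_hahn_banach_closed_point hBc hBcl hx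
  have hd : ∀ s ∈ Set.Icc a b, HasDerivAt (fun s => u * w s - l (G s)) (u * w' s - l (G' s)) s :=
    fun s hs => ((hw s hs).const_mul u).sub (l.hasFDerivAt.comp_hasDerivAt s (hG s hs))
  have hmono : MonotoneOn (fun s => u * w s - l (G s)) (Set.Icc a b) := by
    refine monotoneOn_of_deriv_nonneg (convex_Icc a b)
      (fun s hs => (hd s hs).continuousAt.continuousWithinAt)
      (fun s hs => (hd s (interior_subset hs)).differentiableAt.differentiableWithinAt) ?_
    intro s hs
    have hs' := interior_subset hs
    rw [(hd s hs').deriv]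
    obtain ⟨x, hxB, hx'⟩ := hGw s hs'
    rw [hx', map_smul, smul_eq_mul]
    nlinarith [hl x hxB, hw' s hs']
  have h1 := hmono (Set.left_mem_Icc.2 hab) (Set.right_mem_Icc.2 hab) hab
  rw [map_smul, map_sub, smul_eq_mul, ← div_eq_inv_mul, lt_div_iff₀ hpos] at hu
  simp only at h1
  linarith

/-- The mean value inequality for an extended seminorm `N` with closed balls. -/
lemma extendedSeminorm_sub_le {H : Type*} [NormedAddCommGroup H] [NormedSpace ℂ H] {N : H → ℝ≥0∞}
    (hsmul : ∀ (c : ℂ) h, N (c • h) = ‖c‖ₑ * N h) (hadd : ∀ f g, N (f + g) ≤ N f + N g)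
    (hclosed : ∀ Q, IsClosed {h | N h ≤ Q}) {Q : ℝ≥0∞} {G G' : ℝ → H} {w w' : ℝ → ℝ} {a b : ℝ}
    (hab : a < b)
    (hG : ∀ s ∈ Set.Icc a b, HasDerivAt G (G' s) s)
    (hw : ∀ s ∈ Set.Icc a b, HasDerivAt w (w' s) s)
    (hw' : ∀ s ∈ Set.Icc a b, 0 < w' s)
    (hGw : ∀ s ∈ Set.Icc a b, N (G' s) ≤ ENNReal.ofReal (w' s) * Q) :
    N (G b - G a) ≤ ENNReal.ofReal (w b - w a) * Q := by
  have hreal : ∀ (c : ℝ) h, 0 ≤ c → N (c • h) = ENNReal.ofReal c * N h := by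
    intro c h hc
    rw [← Complex.coe_smul, hsmul, ← ofReal_norm, Complex.norm_real, Real.norm_of_nonneg hc]
  have hconv : Convex ℝ {h | N h ≤ Q} := by
    intro f hf g hg c d hc hd hcd
    calc N (c • f + d • g) ≤ ENNReal.ofReal c * N f + ENNReal.ofReal d * N g := by
          rw [← hreal c f hc, ← hreal d g hd]
          exact hadd _ _
      _ ≤ ENNReal.ofReal c * Q + ENNReal.ofReal d * Q := by gcongr <;> assumption
      _ = Q := by rw [← add_mul, ← ENNReal.ofReal_add hc hd, hcd, ENNReal.ofReal_one, one_mul]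
  have hmono : StrictMonoOn w (Set.Icc a b) := by
    refine strictMonoOn_of_deriv_pos (convex_Icc a b)
      (fun s hs => (hw s hs).continuousAt.continuousWithinAt) fun s hs => ?_
    rw [(hw s (interior_subset hs)).deriv]
    exact hw' s (interior_subset hs)
  have hlt : w a < w b := hmono (Set.left_mem_Icc.2 hab.le) (Set.right_mem_Icc.2 hab.le) hab
  obtain ⟨x, hx, hx'⟩ := exists_mem_sub_eq_smul hconv (hclosed Q) hab.le hlt hG hw
    (fun s hs => (hw' s hs).le) fun s hs => by
      have hc := hw' s hs
      refine ⟨(w' s)⁻¹ • G' s, ?_, (smul_inv_smul₀ hc.ne' _).symm⟩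
      rw [Set.mem_ofPred_eq, hreal _ _ (by positivity)]
      calc _ ≤ ENNReal.ofReal (w' s)⁻¹ * (ENNReal.ofReal (w' s) * Q) := by gcongr; exact hGw s hs
        _ = Q := by
          rw [← mul_assoc, ← ENNReal.ofReal_mul (by positivity), inv_mul_cancel₀ hc.ne',
            ENNReal.ofReal_one, one_mul]
  rw [hx', hreal _ _ (sub_nonneg.2 hlt.le)]
  gcongr
  exact hx

/-! ### Lebesgue norms on `L²` -/

section LebesgueNorm

variable {X V : Type*} [MeasurableSpace X] [NormedAddCommGroup V] {μ : Measure X}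

lemma isClosed_eLpNorm_le (q : ℝ≥0∞) (M : ℝ≥0∞) :
    IsClosed {h : Lp V 2 μ | eLpNorm h q μ ≤ M} := by
  refine IsSeqClosed.isClosed fun u h hu hlim => ?_
  obtain ⟨ns, hns, hae⟩ := (tendstoInMeasure_of_tendsto_Lp hlim).exists_seq_tendsto_ae
  refine (Lp.eLpNorm_lim_le_liminf_eLpNorm (fun k => Lp.aestronglyMeasurable (u (ns k))) h
    hae).trans ?_
  exact liminf_le_of_le (by isBoundedDefault) fun b hb => by
    obtain ⟨k, hk⟩ := hb.exists
    exact hk.trans (hu (ns k))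

lemma eLpNorm_smul_Lp {𝕜 : Type*} [NormedField 𝕜] [NormedSpace 𝕜 V] (c : 𝕜) (h : Lp V 2 μ)
    (q : ℝ≥0∞) :
    eLpNorm (c • h : Lp V 2 μ) q μ = ‖c‖ₑ * eLpNorm h q μ := by
  rw [eLpNorm_congr_ae (Lp.coeFn_smul c h), eLpNorm_const_smul]

lemma eLpNorm_add_Lp_le {q : ℝ≥0∞} (hq : 1 ≤ q) (f g : Lp V 2 μ) :
    eLpNorm (f + g : Lp V 2 μ) q μ ≤ eLpNorm f q μ + eLpNorm g q μ := by
  rw [eLpNorm_congr_ae (Lp.coeFn_add _ _)]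
  exact eLpNorm_add_le (Lp.aestronglyMeasurable _) (Lp.aestronglyMeasurable _) hq

lemma coeFn_restrictL2 {E : Set X} (hE : MeasurableSet E) (f : Lp V 2 μ) :
    restrictL2 hE f =ᵐ[μ] E.indicator f :=
  MemLp.coeFn_toLp _

/-- Multiplication by a bounded continuous function is a bounded operator on `L²`. -/
lemma exists_mul_operator [NormedSpace ℂ V] [TopologicalSpace X] [OpensMeasurableSpace X]
    {g : X → ℝ}
    (hg : Continuous g) {d : ℝ} (hgd : ∀ x, |g x| ≤ d) :
    ∃ M : Lp V 2 μ →L[ℂ] Lp V 2 μ, ∀ f, M f =ᵐ[μ] fun x => (g x : ℂ) • f x := by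
  have hmem : MemLp (fun x => (g x : ℂ)) ∞ μ := by
    refine memLp_top_of_bound ?_ d (Eventually.of_forall fun x => ?_)
    · exact (Complex.measurable_ofReal.comp hg.measurable).aestronglyMeasurable
    · rw [Complex.norm_real]
      exact hgd x
  refine ⟨(ContinuousLinearMap.lsmul ℂ ℂ : ℂ →L[ℂ] V →L[ℂ] V).holderL μ ∞ 2 2 hmem.toLp,
    fun f => ?_⟩
  refine ((ContinuousLinearMap.lsmul ℂ ℂ : ℂ →L[ℂ] V →L[ℂ] V).coeFn_holder (r := 2)
    hmem.toLp f).trans ?_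
  filter_upwards [hmem.coeFn_toLp] with x hx
  simp [hx]

end LebesgueNorm

/-! ### The commutator of the semigroup with a multiplication operator -/

/-- The operators `T(ε ζ)`, `ε → 0+`, may be applied to convergent sequences; this uses the uniform
boundedness principle. -/
lemma IsAnalyticSemigroup.tendsto_apply_seq {H : Type*} [NormedAddCommGroup H] [NormedSpace ℂ H]
    [CompleteSpace H] {ψ : ℝ} {A : Set (H × H)} {T : ℂ → H →L[ℂ] H}
    (hT : IsAnalyticSemigroup ψ A T) {ζ : ℂ} (hζ : ζ ∈ openSector ψ) {ε : ℕ → ℝ}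
    (hε : Tendsto ε atTop (𝓝[>] 0)) {y : ℕ → H} {z : H} (hy : Tendsto y atTop (𝓝 z)) :
    Tendsto (fun k => T (ε k * ζ) (y k)) atTop (𝓝 z) := by
  have hlim : ∀ f, Tendsto (fun k => T (ε k * ζ) f) atTop (𝓝 f) := fun f =>
    (hT.tendsto_ray hζ f).comp hε
  obtain ⟨C, hC⟩ : ∃ C, ∀ k, ‖T (ε k * ζ)‖ ≤ C := by
    refine banach_steinhaus fun f => ?_
    obtain ⟨C, hC⟩ := (hlim f).norm.bddAbove_range
    exact ⟨C, fun k => hC ⟨k, rfl⟩⟩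
  have h0 : Tendsto (fun k => T (ε k * ζ) (y k - z)) atTop (𝓝 0) := by
    refine squeeze_zero_norm (a := fun k => C * ‖y k - z‖)
      (fun k => (T (ε k * ζ)).le_of_opNorm_le (hC k) _) ?_
    simpa using (tendsto_iff_norm_sub_tendsto_zero.1 hy).const_mul C
  simpa using h0.add (hlim z)

lemma rpow_neg_le_two {c v : ℝ} (hc0 : 0 ≤ c) (hc : c < 1) (hv : 1 / 2 ≤ v) : v ^ (-c) ≤ 2 :=
  calc v ^ (-c) ≤ (1 / 2 : ℝ) ^ (-c) :=
        Real.rpow_le_rpow_of_nonpos (by norm_num) hv (by linarith)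
    _ = 2 ^ c := by rw [one_div, Real.inv_rpow (by norm_num), Real.rpow_neg (by norm_num), inv_inv]
    _ ≤ 2 ^ (1 : ℝ) := Real.rpow_le_rpow_of_exponent_le (by norm_num) hc.le
    _ = 2 := Real.rpow_one 2

/-- A majorant of the Beta function integrand with an elementary primitive. -/
lemma rpow_neg_mul_rpow_neg_le {a b u : ℝ} (ha0 : 0 ≤ a) (ha : a < 1) (hb0 : 0 ≤ b) (hb : b < 1)
    (hu0 : 0 < u) (hu1 : u < 1) :
    u ^ (-a) * (1 - u) ^ (-b) ≤ 2 * u ^ (-a) + 2 * (1 - u) ^ (-b) := by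
  have h1 : 0 ≤ u ^ (-a) := by positivity
  have h2 : 0 ≤ (1 - u) ^ (-b) := Real.rpow_nonneg (by linarith) _
  rcases le_total u (1 / 2) with h | h
  · nlinarith [rpow_neg_le_two hb0 hb (by linarith : 1 / 2 ≤ 1 - u)]
  · nlinarith [rpow_neg_le_two ha0 ha h]

section Commutator

variable {X V : Type*} [MeasurableSpace X] [NormedAddCommGroup V] [NormedSpace ℂ V]
  [CompleteSpace V] {μ : Measure X} {ψ : ℝ} {A : Set (Lp V 2 μ × Lp V 2 μ)}
  {T : ℂ → Lp V 2 μ →L[ℂ] Lp V 2 μ}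

/-- The commutator formula
`M T(t ζ) f - T(t ζ) M f = -ζ ∫₀ᵗ T((t - s) ζ) [M, A] T(s ζ) f ds` and the `L^p → L^r` and
`L^r → L^q` bounds of the factors give an `L^q` bound for the commutator. The bound is obtained from
the derivative of `s ↦ T((t - s) ζ) M T(s ζ) f`. -/
lemma eLpNorm_commutator_le (hT : IsAnalyticSemigroup ψ A T) (hψ0 : 0 < ψ) (hψ : ψ ≤ Real.pi / 2)
    {ζ : ℂ} (hζ : ζ ∈ openSector ψ) (hζ1 : ‖ζ‖ = 1) (M : Lp V 2 μ →L[ℂ] Lp V 2 μ)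
    {r q : ℝ≥0∞} (hq : 1 ≤ q) {L P₁ P₂ : ℝ≥0∞} (hP₁ : P₁ ≠ ⊤) {a b : ℝ} (ha0 : 0 ≤ a) (ha : a < 1)
    (hb0 : 0 ≤ b) (hb : b < 1) {t : ℝ} (ht : 0 < t) (f : Lp V 2 μ)
    (hM : ∀ k h, (k, h) ∈ A → MemLp k r μ →
      ∃ h', (M k, h') ∈ A ∧ eLpNorm (h' - M h : Lp V 2 μ) r μ ≤ L * eLpNorm k r μ)
    (hL : L ≠ ⊤)
    (h₁ : ∀ u : ℝ, 0 < u → u < 1 →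
      eLpNorm (T ((u * t : ℝ) * ζ) f) r μ ≤ ENNReal.ofReal (u ^ (-a)) * P₁)
    (h₂ : ∀ u : ℝ, 0 < u → u < 1 → ∀ h : Lp V 2 μ, MemLp h r μ →
      eLpNorm (T ((u * t : ℝ) * ζ) h) q μ ≤ ENNReal.ofReal (u ^ (-b)) * P₂ * eLpNorm h r μ) :
    eLpNorm (M (T (t * ζ) f) - T (t * ζ) (M f) : Lp V 2 μ) q μ ≤
      ENNReal.ofReal (t * (2 / (1 - a) + 2 / (1 - b))) * (L * P₁ * P₂) := by
  -- `w` is the primitive of the majorant of the integrand, rescaled to `(0, t)`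
  set w : ℝ → ℝ := fun s =>
    t * (2 / (1 - a) * (s / t) ^ (1 - a) - 2 / (1 - b) * (1 - s / t) ^ (1 - b)) with hw
  set G : ℝ → Lp V 2 μ := fun s => T ((t - s : ℝ) * ζ) (M (T (s * ζ) f)) with hG
  have ha1 : 0 < 1 - a := by linarith
  have hb1 : 0 < 1 - b := by linarith
  have hut : ∀ s ∈ Set.Ioo 0 t, 0 < s / t ∧ s / t < 1 := fun s hs =>
    ⟨div_pos hs.1 ht, (div_lt_one ht).2 hs.2⟩
  have hwd : ∀ s ∈ Set.Ioo 0 t,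
      HasDerivAt w (2 * (s / t) ^ (-a) + 2 * (1 - s / t) ^ (-b)) s := by
    intro s hs
    obtain ⟨hu0, hu1⟩ := hut s hs
    have hdiv : HasDerivAt (fun s : ℝ => s / t) (1 / t) s := (hasDerivAt_id s).div_const t
    have e1 := hdiv.rpow_const (p := 1 - a) (Or.inl hu0.ne')
    have e2 := (hdiv.const_sub 1).rpow_const (p := 1 - b) (Or.inl (sub_pos.2 hu1).ne')
    refine (((e1.const_mul (2 / (1 - a))).sub (e2.const_mul (2 / (1 - b)))).const_mul
      t).congr_deriv ?_
    rw [show 1 - a - 1 = -a by ring, show 1 - b - 1 = -b by ring]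
    field_simp
    ring
  have hGd : ∀ s ∈ Set.Ioo 0 t, HasDerivAt G
      (ζ • (T ((t - s : ℝ) * ζ) (M (deriv T (s * ζ) f)) -
        deriv T ((t - s : ℝ) * ζ) (M (T (s * ζ) f)))) s :=
    fun s hs => hT.hasDerivAt_conj hT hψ hψ hζ hζ M f hs.1 hs.2
  have hGb : ∀ s ∈ Set.Ioo 0 t,
      eLpNorm (ζ • (T ((t - s : ℝ) * ζ) (M (deriv T (s * ζ) f)) -
        deriv T ((t - s : ℝ) * ζ) (M (T (s * ζ) f))) : Lp V 2 μ) q μ ≤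
      ENNReal.ofReal (2 * (s / t) ^ (-a) + 2 * (1 - s / t) ^ (-b)) * (L * P₁ * P₂) := by
    intro s hs
    obtain ⟨hu0, hu1⟩ := hut s hs
    have hk := h₁ (s / t) hu0 hu1
    rw [div_mul_cancel₀ _ ht.ne'] at hk
    have hkr : MemLp (T (s * ζ) f) r μ :=
      ⟨Lp.aestronglyMeasurable _,
        hk.trans_lt (ENNReal.mul_lt_top ENNReal.ofReal_lt_top hP₁.lt_top)⟩
    obtain ⟨h', hh', hcomm⟩ := hM _ _
      (hT.mem_generator hψ0 hψ (ofReal_mul_mem_openSector hζ hs.1) f) hkr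
    have hmem : MemLp (h' - M (-deriv T (s * ζ) f) : Lp V 2 μ) r μ :=
      ⟨Lp.aestronglyMeasurable _, hcomm.trans_lt (ENNReal.mul_lt_top hL.lt_top hkr.2)⟩
    have h3 := h₂ (1 - s / t) (by linarith) (by linarith) _ hmem
    rw [sub_mul, one_mul, div_mul_cancel₀ _ ht.ne'] at h3
    rw [hT.deriv_apply hψ0 hψ (ofReal_mul_mem_openSector hζ (sub_pos.2 hs.2)) hh', sub_neg_eq_add,
      ← map_add, eLpNorm_smul_Lp, ← ofReal_norm, hζ1, ENNReal.ofReal_one, one_mul]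
    rw [map_neg, sub_neg_eq_add, add_comm h'] at h3 hcomm
    calc _ ≤ _ := h3
      _ ≤ ENNReal.ofReal ((1 - s / t) ^ (-b)) * P₂ *
          (L * (ENNReal.ofReal ((s / t) ^ (-a)) * P₁)) := by
        gcongr
        exact hcomm.trans (by gcongr)
      _ = ENNReal.ofReal ((s / t) ^ (-a) * (1 - s / t) ^ (-b)) * (L * P₁ * P₂) := by
        rw [ENNReal.ofReal_mul (by positivity)]
        ring
      _ ≤ _ := by
        gcongr
        exact rpow_neg_mul_rpow_neg_le ha0 ha hb0 hb hu0 hu1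
  have hwpos : ∀ s ∈ Set.Ioo 0 t, 0 < 2 * (s / t) ^ (-a) + 2 * (1 - s / t) ^ (-b) := by
    intro s hs
    obtain ⟨hu0, hu1⟩ := hut s hs
    have h1 := Real.rpow_pos_of_pos hu0 (-a)
    have h2 := Real.rpow_pos_of_pos (sub_pos.2 hu1) (-b)
    linarith
  have hsub : ∀ x y : ℝ, 0 < x → x < y → y < t →
      eLpNorm (G y - G x : Lp V 2 μ) q μ ≤
        ENNReal.ofReal (t * (2 / (1 - a) + 2 / (1 - b))) * (L * P₁ * P₂) := by
    intro x y hx hxy hy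
    have hIcc : Set.Icc x y ⊆ Set.Ioo 0 t := fun s hs =>
      ⟨hx.trans_le hs.1, hs.2.trans_lt hy⟩
    refine (extendedSeminorm_sub_le (N := fun h : Lp V 2 μ => eLpNorm h q μ)
      (fun c h => eLpNorm_smul_Lp c h q) (eLpNorm_add_Lp_le hq) (isClosed_eLpNorm_le q) hxy
      (fun s hs => hGd s (hIcc hs)) (fun s hs => hwd s (hIcc hs)) (fun s hs => hwpos s (hIcc hs))
      (fun s hs => hGb s (hIcc hs))).trans ?_
    have hwxy : w y - w x ≤ t * (2 / (1 - a) + 2 / (1 - b)) := by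
      obtain ⟨hx0, hx1⟩ := hut x ⟨hx, hxy.trans hy⟩
      obtain ⟨hy0, hy1⟩ := hut y ⟨hx.trans hxy, hy⟩
      have i1 : (y / t) ^ (1 - a) ≤ 1 := Real.rpow_le_one hy0.le hy1.le ha1.le
      have i2 : (1 - x / t) ^ (1 - b) ≤ 1 := Real.rpow_le_one (by linarith) (by linarith) hb1.le
      have i3 : 0 ≤ (x / t) ^ (1 - a) := by positivity
      have i4 : 0 ≤ (1 - y / t) ^ (1 - b) := Real.rpow_nonneg (by linarith) _
      have j1 : 0 ≤ 2 / (1 - a) := by positivity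
      have j2 : 0 ≤ 2 / (1 - b) := by positivity
      simp only [hw]
      rw [← mul_sub]
      refine mul_le_mul_of_nonneg_left ?_ ht.le
      nlinarith [mul_nonneg j1 i3, mul_nonneg j2 i4, mul_le_mul_of_nonneg_left i1 j1,
        mul_le_mul_of_nonneg_left i2 j2]
    gcongr
  -- pass to the limit at both ends of `(0, t)`
  set ε : ℕ → ℝ := fun k => t / ((k : ℝ) + 3) with hε
  have hε0 : ∀ k, 0 < ε k := fun k => by positivity
  have hε1 : ∀ k, ε k < t - ε k := fun k => by
    have : ε k ≤ t / 3 := by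
      simp only [hε]
      gcongr
      linarith [(Nat.cast_nonneg k : (0 : ℝ) ≤ k)]
    linarith
  have hεlim : Tendsto ε atTop (𝓝 0) :=
    Tendsto.const_div_atTop (tendsto_atTop_add_const_right _ _ tendsto_natCast_atTop_atTop) t
  have hεlim' : Tendsto ε atTop (𝓝[>] 0) :=
    tendsto_nhdsWithin_iff.2 ⟨hεlim, Eventually.of_forall hε0⟩
  have hTlim : Tendsto (fun k => T ((t - ε k : ℝ) * ζ)) atTop (𝓝 (T (t * ζ))) := by
    refine (hT.hasDerivAt_ray hψ hζ ht).continuousAt.tendsto.comp ?_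
    simpa using hεlim.const_sub t
  have l1 : Tendsto (fun k => G (ε k)) atTop (𝓝 (T (t * ζ) (M f))) :=
    (isBoundedBilinearMap_apply.continuous.tendsto (T (t * ζ), M f)).comp
      (hTlim.prodMk_nhds ((M.continuous.tendsto f).comp ((hT.tendsto_ray hζ f).comp hεlim')))
  have l2 : Tendsto (fun k => G (t - ε k)) atTop (𝓝 (M (T (t * ζ) f))) := by
    have := hT.tendsto_apply_seq hζ hεlim' ((M.continuous.tendsto _).comp
      ((isBoundedBilinearMap_apply.continuous.tendsto (T (t * ζ), f)).comp
        (hTlim.prodMk_nhds tendsto_const_nhds)))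
    refine this.congr fun k => ?_
    simp [hG]
  exact (isClosed_eLpNorm_le q _).mem_of_tendsto (l2.sub l1)
    (Eventually.of_forall fun k => hsub _ _ (hε0 k) (hε1 k) (by linarith [hε0 k]))

end Commutator

/-! ### Off-diagonal estimates along a ray -/

/-- The factor `(t ∧ D)^{-a}` at time `u t`, `0 < u ≤ 1`, is controlled by the one at time `t`. -/
lemma min_ofReal_mul_rpow_neg_le {D : ℝ≥0∞} {a t u : ℝ} (ha : 0 ≤ a) (hu0 : 0 < u)
    (hu1 : u ≤ 1) :
    (min (ENNReal.ofReal (u * t)) D) ^ (-a) ≤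
      ENNReal.ofReal (u ^ (-a)) * (min (ENNReal.ofReal t) D) ^ (-a) := by
  have h1 : ENNReal.ofReal u * min (ENNReal.ofReal t) D ≤ min (ENNReal.ofReal (u * t)) D := by
    refine le_min ?_ ?_
    · rw [ENNReal.ofReal_mul hu0.le]
      gcongr
      exact min_le_left _ _
    · calc _ ≤ 1 * D := by
            gcongr
            · exact ENNReal.ofReal_le_one.2 hu1
            · exact min_le_right _ _
        _ = D := one_mul D
  rw [← ENNReal.ofReal_rpow_of_pos hu0,
    ← ENNReal.mul_rpow_of_ne_top ENNReal.ofReal_ne_top (by simp)]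
  rw [ENNReal.rpow_neg, ENNReal.rpow_neg]
  gcongr

lemma rpow_neg_mul_rpow_neg_ennreal {x : ℝ≥0∞} (hx : x ≠ ⊤) {a b : ℝ} (ha : 0 ≤ a) (hb : 0 ≤ b) :
    x ^ (-a) * x ^ (-b) = x ^ (-(a + b)) := by
  rw [ENNReal.rpow_neg, ENNReal.rpow_neg, ENNReal.rpow_neg, ENNReal.rpow_add_of_nonneg _ _ ha hb,
    ENNReal.mul_inv]
  · exact Or.inr (ENNReal.rpow_ne_top_of_nonneg hb hx)
  · exact Or.inl (ENNReal.rpow_ne_top_of_nonneg ha hx)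

/-- The cut-off distance to `E`: it vanishes on `E` and equals `dist(E, F)` on `F`. -/
lemma exists_lipschitz_cutoff {X : Type*} [MetricSpace X] {E F : Set X} (hE : E.Nonempty)
    (hF : F.Nonempty) :
    setDist E F ≠ ⊤ ∧ ∃ g : X → ℝ, LipschitzWith 1 g ∧
      (∀ x, |g x| ≤ (setDist E F).toReal) ∧ (∀ x ∈ E, g x = 0) ∧
      ∀ x ∈ F, g x = (setDist E F).toReal := by
  have hle : ∀ x ∈ E, ∀ y ∈ F, setDist E F ≤ edist x y := fun x hx y hy =>
    (iInf₂_le x hx).trans (iInf₂_le y hy)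
  have hfin : setDist E F ≠ ⊤ :=
    ((hle _ hE.some_mem _ hF.some_mem).trans_lt (edist_lt_top _ _)).ne
  refine ⟨hfin, fun x => min (Metric.infDist x E) (setDist E F).toReal,
    (Metric.lipschitz_infDist_pt E).min_const _, fun x => ?_, fun x hx => ?_, fun x hx => ?_⟩
  · rw [abs_of_nonneg (le_min Metric.infDist_nonneg ENNReal.toReal_nonneg)]
    exact min_le_right _ _
  · simp [Metric.infDist_zero_of_mem hx]
  · refine min_eq_right ((Metric.le_infDist hE).2 fun y hy => ?_)
    rw [dist_comm, dist_edist]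
    exact ENNReal.toReal_mono (edist_ne_top _ _) (hle y hy x hx)

/-- The constant in the off-diagonal estimate. The term with `K₀` bounds the commutator, the first
one the operators themselves, and `1` makes the constant positive. -/
noncomputable def offDiagonalConst (a b : ℝ) (K₀ K₁ K₂ : ℝ≥0) : ℝ≥0 :=
  8 * K₁ * K₂ + 2 * (K₀ * K₁ * K₂) * (2 / (1 - a) + 2 / (1 - b)).toNNReal + 1

/-- For separated sets `E` and `F`, the operator `1_F T 1_E` is `dist(E, F)⁻¹` times the restricted
commutator of `T` with the cut-off distance. -/
lemma ofReal_mul_eLpNorm_indicator_le {X V : Type*} [MeasurableSpace X] [NormedAddCommGroup V]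
    [NormedSpace ℂ V] {μ : Measure X} {q : ℝ≥0∞} {E F : Set X} (hE : MeasurableSet E)
    {g : X → ℝ} {d : ℝ} (hd : 0 ≤ d) (hgE : ∀ x ∈ E, g x = 0)
    (hgF : ∀ x ∈ F, g x = d) {M : Lp V 2 μ →L[ℂ] Lp V 2 μ}
    (hM : ∀ f, M f =ᵐ[μ] fun x => (g x : ℂ) • f x) (S : Lp V 2 μ →L[ℂ] Lp V 2 μ) (f : Lp V 2 μ) :
    ENNReal.ofReal d * eLpNorm (F.indicator (S (restrictL2 hE f))) q μ ≤
      eLpNorm (M (S (restrictL2 hE f)) - S (M (restrictL2 hE f)) : Lp V 2 μ) q μ := by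
  have h0 : M (restrictL2 hE f) = 0 := by
    refine Lp.ext ?_
    filter_upwards [hM (restrictL2 hE f), coeFn_restrictL2 hE f, Lp.coeFn_zero V 2 μ]
      with x h1 h2 h3
    rw [h1, h2, h3]
    by_cases hx : x ∈ E
    · simp [hgE x hx]
    · simp [hx]
  rw [h0, map_zero, sub_zero, ← Real.enorm_of_nonneg hd, ← eLpNorm_const_smul]
  have hae : (d • F.indicator (S (restrictL2 hE f)) : X → V) =ᵐ[μ]
      F.indicator (M (S (restrictL2 hE f))) := by
    filter_upwards [hM (S (restrictL2 hE f))] with x hx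
    by_cases hxF : x ∈ F
    · simp [hxF, hx, hgF x hxF]
    · simp [hxF]
  rw [eLpNorm_congr_ae hae]
  exact eLpNorm_indicator_le _

/-- Off-diagonal estimates of order one at the times `t ζ`, `t > 0`, for an analytic semigroup whose
generator has bounded commutators with Lipschitz functions. -/
lemma offDiagonal_ray {X V : Type*} [MetricSpace X] [MeasurableSpace X] [OpensMeasurableSpace X]
    [NormedAddCommGroup V] [NormedSpace ℂ V] [CompleteSpace V] {μ : Measure X} {ψ : ℝ}
    {A : Set (Lp V 2 μ × Lp V 2 μ)} {T : ℂ → Lp V 2 μ →L[ℂ] Lp V 2 μ}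
    (hT : IsAnalyticSemigroup ψ A T) (hψ0 : 0 < ψ) (hψ : ψ ≤ Real.pi / 2)
    {ζ : ℂ} (hζ : ζ ∈ openSector ψ) (hζ1 : ‖ζ‖ = 1)
    {p q r : ℝ≥0∞} (hp : 1 ≤ p) (hq : 1 ≤ q) {K₀ K₁ K₂ : ℝ≥0} {a b : ℝ} (ha0 : 0 ≤ a) (ha : a < 1)
    (hb0 : 0 ≤ b) (hb : b < 1)
    (hcomm : ∀ (g : X → ℝ) (M : Lp V 2 μ →L[ℂ] Lp V 2 μ), LipschitzWith 1 g →
      (∀ f, M f =ᵐ[μ] fun x => (g x : ℂ) • f x) → ∀ k h, (k, h) ∈ A → MemLp k r μ →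
      ∃ h', (M k, h') ∈ A ∧ eLpNorm (h' - M h : Lp V 2 μ) r μ ≤ K₀ * eLpNorm k r μ)
    (h₁ : ∀ s : ℝ, 0 < s → ∀ f : Lp V 2 μ, MemLp f p μ → eLpNorm (T (s * ζ) f) r μ ≤
      K₁ * (min (ENNReal.ofReal s) (Metric.ediam (Set.univ : Set X))) ^ (-a) * eLpNorm f p μ)
    (h₂ : ∀ s : ℝ, 0 < s → ∀ f : Lp V 2 μ, MemLp f r μ → eLpNorm (T (s * ζ) f) q μ ≤
      K₂ * (min (ENNReal.ofReal s) (Metric.ediam (Set.univ : Set X))) ^ (-b) * eLpNorm f r μ)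
    {t : ℝ} (ht : 0 < t) {f : Lp V 2 μ} (hf : MemLp f p μ) {E F : Set X} (hE : MeasurableSet E) :
    eLpNorm (F.indicator (T (t * ζ) (restrictL2 hE f))) q μ ≤
      (offDiagonalConst a b K₀ K₁ K₂ : ℝ≥0∞) *
        (min (ENNReal.ofReal t) (Metric.ediam (Set.univ : Set X))) ^ (-(a + b)) *
        (1 + setDist E F / ENNReal.ofReal t) ^ (-1 : ℝ) * eLpNorm (E.indicator f) p μ := by
  set D := Metric.ediam (Set.univ : Set X)
  set e := restrictL2 hE f with he
  have hep : eLpNorm e p μ = eLpNorm (E.indicator f) p μ :=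
    eLpNorm_congr_ae (coeFn_restrictL2 hE f)
  have heE : MemLp e p μ := (memLp_congr_ae (coeFn_restrictL2 hE f)).2 (hf.indicator hE)
  rw [← hep]
  set m := eLpNorm e p μ with hm
  have hmtop : m ≠ ⊤ := heE.2.ne
  by_cases he0 : e = 0
  · refine (eLpNorm_indicator_le _).trans ?_
    rw [he0, map_zero, eLpNorm_congr_ae (Lp.coeFn_zero V 2 μ), eLpNorm_zero]
    exact zero_le
  rcases F.eq_empty_or_nonempty with rfl | hFn
  · simp
  have hEn : E.Nonempty := by
    by_contra h
    rw [Set.not_nonempty_iff_eq_empty] at h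
    refine he0 (Lp.ext ?_)
    filter_upwards [coeFn_restrictL2 hE f, Lp.coeFn_zero V 2 μ] with x h1 h2
    rw [he, h1, h2, h]
    simp
  obtain ⟨hdtop, g, hgL, hgd, hgE, hgF⟩ := exists_lipschitz_cutoff hEn hFn
  set d := (setDist E F).toReal with hd
  have hd0 : 0 ≤ d := ENNReal.toReal_nonneg
  have hm0 : m ≠ 0 := fun h => he0 ((Lp.eq_zero_iff_ae_eq_zero).2
    ((eLpNorm_eq_zero_iff (Lp.aestronglyMeasurable e) (by positivity)).1 h))
  have hfac : (1 + setDist E F / ENNReal.ofReal t) ^ (-1 : ℝ) =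
      ENNReal.ofReal ((1 + d / t)⁻¹) := by
    rw [ENNReal.rpow_neg_one, ENNReal.ofReal_inv_of_pos (by positivity),
      ENNReal.ofReal_add zero_le_one (by positivity), ENNReal.ofReal_one,
      ENNReal.ofReal_div_of_pos ht, ENNReal.ofReal_toReal hdtop]
  set x := min (ENNReal.ofReal t) D with hx
  have hxtop : x ≠ ⊤ := by simp [hx]
  rw [hfac]
  -- if `X` has diameter zero, then the power may be infinite, and so is the right-hand side
  by_cases hY : x ^ (-(a + b)) = ⊤
  · have hC0 : (offDiagonalConst a b K₀ K₁ K₂ : ℝ≥0∞) ≠ 0 := by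
      simp [offDiagonalConst]
    have h3 : ENNReal.ofReal ((1 + d / t)⁻¹) ≠ 0 := by
      rw [Ne, ENNReal.ofReal_eq_zero, not_le]
      positivity
    rw [hY, ENNReal.mul_top hC0, ENNReal.top_mul h3, ENNReal.top_mul hm0]
    exact le_top
  have hsplit := rpow_neg_mul_rpow_neg_ennreal hxtop ha0 hb0
  have hxa : x ^ (-a) ≠ ⊤ := by
    intro h
    rw [← hsplit, h] at hY
    refine hY (ENNReal.top_mul ?_)
    simp [ENNReal.rpow_eq_zero_iff, hxtop, hb0]
  -- the on-diagonal bound, by splitting the time into two halves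
  have hone : eLpNorm (F.indicator (T (t * ζ) e)) q μ ≤
      ENNReal.ofReal (4 * (K₁ * K₂)) * (x ^ (-(a + b)) * m) := by
    have hhalf : ∀ c : ℝ, 0 ≤ c → c < 1 →
        (min (ENNReal.ofReal (1 / 2 * t)) D) ^ (-c) ≤ ENNReal.ofReal 2 * x ^ (-c) := by
      intro c hc0 hc
      refine (min_ofReal_mul_rpow_neg_le hc0 (by norm_num) (by norm_num)).trans ?_
      gcongr
      exact rpow_neg_le_two hc0 hc le_rfl
    have ht2 : 0 < 1 / 2 * t := by positivity
    have hsemi : T (t * ζ) e = T ((1 / 2 * t : ℝ) * ζ) (T ((1 / 2 * t : ℝ) * ζ) e) := by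
      rw [← ContinuousLinearMap.comp_apply, ← hT.add _ (ofReal_mul_mem_openSector hζ ht2) _
        (ofReal_mul_mem_openSector hζ ht2), ← add_mul, ← Complex.ofReal_add]
      congr 4
      ring
    have hr := (h₁ _ ht2 e heE).trans (by gcongr; exact hhalf a ha0 ha :
      _ ≤ K₁ * (ENNReal.ofReal 2 * x ^ (-a)) * m)
    have hrm : MemLp (T ((1 / 2 * t : ℝ) * ζ) e) r μ :=
      ⟨Lp.aestronglyMeasurable _, hr.trans_lt (by finiteness)⟩
    refine (eLpNorm_indicator_le _).trans ?_
    rw [hsemi]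
    refine (h₂ _ ht2 _ hrm).trans ?_
    calc _ ≤ K₂ * (ENNReal.ofReal 2 * x ^ (-b)) * (K₁ * (ENNReal.ofReal 2 * x ^ (-a)) * m) := by
          gcongr
          exact hhalf b hb0 hb
      _ = _ := by
          rw [show (4 : ℝ) * (K₁ * K₂) = 2 * 2 * (K₁ * K₂) by ring,
            ENNReal.ofReal_mul (by positivity), ENNReal.ofReal_mul (by positivity),
            ENNReal.ofReal_mul (p := (K₁ : ℝ)) (by positivity), ENNReal.ofReal_coe_nnreal,
            ENNReal.ofReal_coe_nnreal, ← hsplit]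
          ring
  -- the commutator bound
  have htwo : ENNReal.ofReal d * eLpNorm (F.indicator (T (t * ζ) e)) q μ ≤
      ENNReal.ofReal (t * (2 / (1 - a) + 2 / (1 - b)) * (K₀ * K₁ * K₂)) *
        (x ^ (-(a + b)) * m) := by
    obtain ⟨M, hM⟩ := exists_mul_operator (V := V) (μ := μ) hgL.continuous hgd
    refine (ofReal_mul_eLpNorm_indicator_le hE hd0 hgE hgF hM _ f).trans ?_
    refine (eLpNorm_commutator_le hT hψ0 hψ hζ hζ1 M hq (L := K₀) (P₁ := K₁ * x ^ (-a) * m)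
      (P₂ := K₂ * x ^ (-b)) (by finiteness) ha0 ha hb0 hb ht e
      (hcomm g M hgL hM) ENNReal.coe_ne_top ?_ ?_).trans_eq ?_
    · intro u hu0 hu1
      refine (h₁ _ (mul_pos hu0 ht) e heE).trans ?_
      calc _ ≤ K₁ * (ENNReal.ofReal (u ^ (-a)) * x ^ (-a)) * m := by
            gcongr
            exact min_ofReal_mul_rpow_neg_le ha0 hu0 hu1.le
        _ = _ := by ring
    · intro u hu0 hu1 h hh
      refine (h₂ _ (mul_pos hu0 ht) h hh).trans ?_
      calc _ ≤ K₂ * (ENNReal.ofReal (u ^ (-b)) * x ^ (-b)) * eLpNorm h r μ := by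
            gcongr
            exact min_ofReal_mul_rpow_neg_le hb0 hu0 hu1.le
        _ = _ := by ring
    · have hB : 0 ≤ t * (2 / (1 - a) + 2 / (1 - b)) := by
        have := sub_pos.2 ha
        have := sub_pos.2 hb
        positivity
      rw [ENNReal.ofReal_mul hB, ENNReal.ofReal_mul (by positivity),
        ENNReal.ofReal_mul (by positivity), ENNReal.ofReal_mul (p := (K₀ : ℝ)) (by positivity),
        ENNReal.ofReal_coe_nnreal, ENNReal.ofReal_coe_nnreal, ENNReal.ofReal_coe_nnreal, ← hsplit]
      ring
  have hB : 0 ≤ 2 / (1 - a) + 2 / (1 - b) := by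
    have := sub_pos.2 ha
    have := sub_pos.2 hb
    positivity
  have hC : (offDiagonalConst a b K₀ K₁ K₂ : ℝ) =
      8 * K₁ * K₂ + 2 * (K₀ * K₁ * K₂) * (2 / (1 - a) + 2 / (1 - b)) + 1 := by
    simp only [offDiagonalConst]
    push_cast
    rw [Real.coe_toNNReal _ hB]
  have hK12 : 0 ≤ (K₁ : ℝ) * K₂ := by positivity
  have hK012 : 0 ≤ (K₀ * K₁ * K₂ : ℝ) * (2 / (1 - a) + 2 / (1 - b)) :=
    mul_nonneg (by positivity) hB
  have hfin : ∀ c : ℝ, c * (1 + d / t) ≤ offDiagonalConst a b K₀ K₁ K₂ →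
      ENNReal.ofReal c * (x ^ (-(a + b)) * m) ≤ (offDiagonalConst a b K₀ K₁ K₂ : ℝ≥0∞) *
        x ^ (-(a + b)) * ENNReal.ofReal ((1 + d / t)⁻¹) * m := by
    intro c hc
    rw [← le_div_iff₀ (by positivity), div_eq_mul_inv] at hc
    calc _ ≤ ENNReal.ofReal (offDiagonalConst a b K₀ K₁ K₂ * (1 + d / t)⁻¹) *
          (x ^ (-(a + b)) * m) := by gcongr
      _ = _ := by
        rw [ENNReal.ofReal_mul (by positivity), ENNReal.ofReal_coe_nnreal]
        ring
  rcases le_or_gt d t with hdt | hdt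
  · refine hone.trans (hfin _ ?_)
    have h4 : d / t ≤ 1 := (div_le_one ht).2 hdt
    rw [hC]
    nlinarith
  · have hdpos : 0 < d := ht.trans hdt
    have h4 : eLpNorm (F.indicator (T (t * ζ) e)) q μ ≤
        ENNReal.ofReal (t / d * ((K₀ * K₁ * K₂) * (2 / (1 - a) + 2 / (1 - b)))) *
          (x ^ (-(a + b)) * m) := by
      calc _ = ENNReal.ofReal d⁻¹ *
            (ENNReal.ofReal d * eLpNorm (F.indicator (T (t * ζ) e)) q μ) := by
            rw [← mul_assoc, ← ENNReal.ofReal_mul (by positivity), inv_mul_cancel₀ hdpos.ne',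
              ENNReal.ofReal_one, one_mul]
        _ ≤ ENNReal.ofReal d⁻¹ * (ENNReal.ofReal (t * (2 / (1 - a) + 2 / (1 - b)) *
            (K₀ * K₁ * K₂)) * (x ^ (-(a + b)) * m)) := by gcongr
        _ = _ := by
            rw [← mul_assoc, ← ENNReal.ofReal_mul (by positivity)]
            congr 2
            ring
    refine h4.trans (hfin _ ?_)
    have h5 : t / d ≤ 1 := (div_le_one hdpos).2 hdt.le
    have h6 : t / d * (1 + d / t) = t / d + 1 := by
      field_simp
    calc _ = (K₀ * K₁ * K₂ : ℝ) * (2 / (1 - a) + 2 / (1 - b)) * (t / d * (1 + d / t)) := by ring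
      _ ≤ (K₀ * K₁ * K₂ : ℝ) * (2 / (1 - a) + 2 / (1 - b)) * 2 := by
        refine mul_le_mul_of_nonneg_left ?_ hK012
        linarith
      _ ≤ _ := by
        rw [hC]
        nlinarith

/-! ### The Dirichlet-to-Neumann semigroup -/

lemma exists_isAnalyticSemigroup_expNeg {H : Type*} [NormedAddCommGroup H] [NormedSpace ℂ H]
    {A : Set (H × H)} (h : ∃ ψ : ℝ, (0 < ψ ∧ ψ ≤ Real.pi / 2) ∧
      ∃ T : ℂ → H →L[ℂ] H, IsAnalyticSemigroup ψ A T) :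
    ∃ ψ : ℝ, (0 < ψ ∧ ψ ≤ Real.pi / 2) ∧ IsAnalyticSemigroup ψ A (expNeg A) := by
  refine ⟨h.choose, h.choose_spec.1, ?_⟩
  rw [expNeg, dif_pos h]
  exact h.choose_spec.2.choose_spec

lemma isAnalyticSemigroup_expNegSector {H : Type*} [NormedAddCommGroup H] [NormedSpace ℂ H]
    {ψ : ℝ} {A : Set (H × H)} (h : ∃ T : ℂ → H →L[ℂ] H, IsAnalyticSemigroup ψ A T) :
    IsAnalyticSemigroup ψ A (expNegSector ψ A) := by
  rw [expNegSector, dif_pos h]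
  exact h.choose_spec

section Estimates

variable {X V : Type*} [MetricSpace X] [MeasurableSpace X] [NormedAddCommGroup V]
  [NormedSpace ℂ V] {μ : Measure X}

lemma offDiagonalEstimates_zero (n : ℝ) (U : Set ℂ) (p q : ℝ≥0∞) (γ : ℝ) (C : ℝ≥0) :
    OffDiagonalEstimates μ n U (0 : ℂ → Lp V 2 μ →L[ℂ] Lp V 2 μ) p q γ C := by
  intro z _ f _ E F hE _
  refine (eLpNorm_indicator_le _).trans ?_
  rw [Pi.zero_apply, zero_apply, eLpNorm_congr_ae (Lp.coeFn_zero V 2 μ),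
    eLpNorm_zero]
  exact zero_le

lemma LpLqBounded.eLpNorm_le {n : ℝ} {U : Set ℂ} {T : ℂ → Lp V 2 μ →L[ℂ] Lp V 2 μ} {p q : ℝ≥0∞}
    {C : ℝ≥0} (h : LpLqBounded μ n U T p q C) {z : ℂ} (hz : z ∈ U) {f : Lp V 2 μ}
    (hf : MemLp f p μ) :
    eLpNorm (T z f) q μ ≤ C * (min ‖z‖ₑ (Metric.ediam (Set.univ : Set X))) ^
      (n * recip q - n * recip p) * eLpNorm f p μ := by
  have h1 := h z hz f hf Set.univ Set.univ MeasurableSet.univ MeasurableSet.univ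
  have h2 : restrictL2 MeasurableSet.univ f = f := by
    refine Lp.ext ((coeFn_restrictL2 MeasurableSet.univ f).trans ?_)
    rw [Set.indicator_univ]
  simpa [h2] using h1

end Estimates

/-- A commutator bound is insensitive to shifts of the operator. -/
lemma exists_commutator_shift {X V : Type*} [MeasurableSpace X] [NormedAddCommGroup V]
    [NormedSpace ℂ V] {μ : Measure X} {N : Set (Lp V 2 μ × Lp V 2 μ)} {r L : ℝ≥0∞} {g : X → ℝ}
    (hdom : ∀ f h : Lp V 2 μ, (f, h) ∈ N → ∃ f' h' : Lp V 2 μ, (f', h') ∈ N ∧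
      f' =ᵐ[μ] fun x => (g x : ℂ) • f x)
    (hbound : ∀ f h f' h' : Lp V 2 μ, (f, h) ∈ N → (f', h') ∈ N →
      f' =ᵐ[μ] (fun x => (g x : ℂ) • f x) → MemLp f r μ →
      eLpNorm (fun x => h' x - (g x : ℂ) • h x) r μ ≤ L * eLpNorm f r μ)
    (κ : ℝ) {M : Lp V 2 μ →L[ℂ] Lp V 2 μ} (hM : ∀ f, M f =ᵐ[μ] fun x => (g x : ℂ) • f x)
    {k h : Lp V 2 μ} (hkh : (k, h) ∈ shiftGraph N κ) (hk : MemLp k r μ) :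
    ∃ h', (M k, h') ∈ shiftGraph N κ ∧
      eLpNorm (h' - M h : Lp V 2 μ) r μ ≤ L * eLpNorm k r μ := by
  have hN' : (k, h - (κ : ℂ) • k) ∈ N := hkh
  obtain ⟨f', h', hfh, hf'⟩ := hdom _ _ hN'
  obtain rfl : f' = M k := Lp.ext (hf'.trans (hM k).symm)
  refine ⟨h' + (κ : ℂ) • M k, ?_, ?_⟩
  · change (M k, h' + (κ : ℂ) • M k - (κ : ℂ) • M k) ∈ N
    rwa [add_sub_cancel_right]
  have h1 := hbound _ _ _ _ hN' hfh hf' hk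
  have h2 : h' + (κ : ℂ) • M k - M h = h' - M (h - (κ : ℂ) • k) := by
    rw [map_sub, map_smul]
    abel
  rw [h2]
  refine (eLpNorm_congr_ae ?_).trans_le h1
  filter_upwards [Lp.coeFn_sub h' (M (h - (κ : ℂ) • k)), hM (h - (κ : ℂ) • k)] with x e1 e2
  rw [e1, Pi.sub_apply, e2]

lemma CommutatorBound.exists_shift {n m : ℕ} {Ω : Set (Space n)}
    {N : Set (L2Bdry m Ω × L2Bdry m Ω)} {r : ℝ≥0∞} {C : ℝ≥0} (hN : CommutatorBound N r C) (κ : ℝ)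
    (g : frontier Ω → ℝ) (M : L2Bdry m Ω →L[ℂ] L2Bdry m Ω) (hg : LipschitzWith 1 g)
    (hM : ∀ f, M f =ᵐ[surfaceMeasure Ω] fun x => (g x : ℂ) • f x) (k h : L2Bdry m Ω)
    (hkh : (k, h) ∈ shiftGraph N κ) (hk : MemLp k r (surfaceMeasure Ω)) :
    ∃ h', (M k, h') ∈ shiftGraph N κ ∧
      eLpNorm (h' - M h : L2Bdry m Ω) r (surfaceMeasure Ω) ≤
        C * eLpNorm k r (surfaceMeasure Ω) := by
  obtain ⟨hdom, hbound⟩ := hN g 1 hg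
  simp only [ENNReal.coe_one, mul_one] at hbound
  exact exists_commutator_shift hdom hbound κ hM hkh hk

lemma shiftGraph_zero {H : Type*} [NormedAddCommGroup H] [NormedSpace ℂ H] (A : Set (H × H)) :
    shiftGraph A 0 = A := by
  simp [shiftGraph]

theorem theorem3p5 (n : ℕ) (hn : 1 ≤ n) (p q r : ℝ≥0∞) (hp : 1 ≤ p) (hq : 1 ≤ q) (hr : 1 ≤ r)
    (h₁ : recip p < recipLowerSobolev n r) (h₂ : recip r ≤ recip p) (h₃ : recip q ≤ recip r)
    (h₄ : recipUpperSobolev n r < recip q) :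
    (∀ K₀ K₁ K₂ : ℝ≥0, ∃ C : ℝ≥0,
      ∀ (m : ℕ) (Ω : Set (Space n)) (A : Coeff n m),
        1 ≤ m → IsBoundedLipschitzDomain Ω → IsElliptic Ω A →
        CommutatorBound (dirichletToNeumann Ω A) r K₀ →
        LpLqBounded (surfaceMeasure Ω) n positiveTimes (expNeg (dirichletToNeumann Ω A)) p r K₁ →
        LpLqBounded (surfaceMeasure Ω) n positiveTimes (expNeg (dirichletToNeumann Ω A)) r q K₂ →
        OffDiagonalEstimates (surfaceMeasure Ω) n positiveTimes
          (expNeg (dirichletToNeumann Ω A)) p q 1 C) ∧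
    (r = 2 → ∀ (K₀ K₁ K₂ : ℝ≥0) (θ φ : ℝ), 0 ≤ θ → θ < Real.pi / 2 →
      0 ≤ φ → φ < Real.pi / 2 - θ → ∃ C : ℝ≥0,
      ∀ (m : ℕ) (Ω : Set (Space n)) (A : Coeff n m) (κ : ℝ),
        1 ≤ m → IsBoundedLipschitzDomain Ω → IsElliptic Ω A → IsAdmissibleShift Ω A κ →
        NumericalRangeInSector (shiftGraph (dirichletToNeumann Ω A) κ) θ →
        CommutatorBound (dirichletToNeumann Ω A) 2 K₀ →
        LpLqBounded (surfaceMeasure Ω) n positiveTimes (expNeg (dirichletToNeumann Ω A)) p 2 K₁ →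
        LpLqBounded (surfaceMeasure Ω) n positiveTimes (expNeg (dirichletToNeumann Ω A)) 2 q K₂ →
        OffDiagonalEstimates (surfaceMeasure Ω) n (sector φ)
          (expNegSector (Real.pi / 2 - θ) (shiftGraph (dirichletToNeumann Ω A) κ)) p q 1 C) := by
  -- the exponents of the two factors; the Sobolev-type conditions say that they are less than one
  have hn0 : (0 : ℝ) < n := by exact_mod_cast hn
  have hnn : (n : ℝ) * (1 / n) = 1 := mul_one_div_cancel hn0.ne'
  obtain ⟨a, ha⟩ : ∃ a : ℝ, a = n * recip p - n * recip r := ⟨_, rfl⟩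
  obtain ⟨b, hb⟩ : ∃ b : ℝ, b = n * recip r - n * recip q := ⟨_, rfl⟩
  have ha0 : 0 ≤ a := by
    rw [ha]
    exact sub_nonneg.2 (by gcongr)
  have hb0 : 0 ≤ b := by
    rw [hb]
    exact sub_nonneg.2 (by gcongr)
  have ha1 : a < 1 := by
    rw [recipLowerSobolev] at h₁
    nlinarith [mul_lt_mul_of_pos_left h₁ hn0]
  have hb1 : b < 1 := by
    rw [recipUpperSobolev] at h₄
    nlinarith [mul_lt_mul_of_pos_left h₄ hn0]
  have hpr : (n : ℝ) * recip r - n * recip p = -a := by rw [ha]; ring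
  have hrq : (n : ℝ) * recip q - n * recip r = -b := by rw [hb]; ring
  have hpq : (n : ℝ) * recip q - n * recip p = -(a + b) := by rw [ha, hb]; ring
  have hnorm : ∀ s : ℝ, 0 < s → ‖(s : ℂ)‖ₑ = ENNReal.ofReal s := fun s hs => by
    rw [← ofReal_norm, Complex.norm_real, Real.norm_of_nonneg hs.le]
  refine ⟨fun K₀ K₁ K₂ => ⟨offDiagonalConst a b K₀ K₁ K₂, ?_⟩, ?_⟩
  · intro m Ω A _ _ _ hC hK₁ hK₂
    by_cases hex : ∃ ψ : ℝ, (0 < ψ ∧ ψ ≤ Real.pi / 2) ∧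
        ∃ T, IsAnalyticSemigroup ψ (dirichletToNeumann Ω A) T
    -- in the absence of a semigroup the family is zero by convention
    swap
    · rw [expNeg, dif_neg hex]
      exact offDiagonalEstimates_zero _ _ _ _ _ _
    obtain ⟨ψ, ⟨hψ0, hψ⟩, hT⟩ := exists_isAnalyticSemigroup_expNeg hex
    rintro _ ⟨t, ht, rfl⟩ f hf E F hE _
    have hζ : (1 : ℂ) ∈ openSector ψ := by simpa using ofReal_mem_openSector hψ0 one_pos
    have hcomm := hC.exists_shift 0
    rw [shiftGraph_zero] at hcomm
    have := offDiagonal_ray hT hψ0 hψ hζ norm_one hp hq (K₁ := K₁) (K₂ := K₂) ha0 ha1 hb0 hb1 hcomm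
      (fun s hs f hf => by
        have := hK₁.eLpNorm_le ⟨s, hs, rfl⟩ hf
        rwa [hpr, hnorm s hs, ← mul_one (s : ℂ)] at this)
      (fun s hs f hf => by
        have := hK₂.eLpNorm_le ⟨s, hs, rfl⟩ hf
        rwa [hrq, hnorm s hs, ← mul_one (s : ℂ)] at this) ht hf hE (F := F)
    rwa [mul_one, ← hpq, ← hnorm t ht] at this
  · rintro rfl K₀ K₁ K₂ θ φ hθ0 hθ hφ0 hφ
    have hψ : Real.pi / 2 - θ ≤ Real.pi / 2 := by linarith
    have hψ0 : 0 < Real.pi / 2 - θ := by linarith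
    obtain ⟨δ, hδ0, hδ1, hδ⟩ := exists_sub_norm_mem_openSector hφ hψ
    refine ⟨offDiagonalConst a b K₀ (K₁ * (δ ^ (-a)).toNNReal) (K₂ * (δ ^ (-b)).toNNReal), ?_⟩
    intro m Ω A κ _ _ _ hκ hnum hC hK₁ hK₂
    by_cases hex : ∃ T, IsAnalyticSemigroup (Real.pi / 2 - θ)
        (shiftGraph (dirichletToNeumann Ω A) κ) T
    -- in the absence of a semigroup the family is zero by convention
    swap
    · rw [expNegSector, dif_neg hex]
      exact offDiagonalEstimates_zero _ _ _ _ _ _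
    have hT := isAnalyticSemigroup_expNegSector hex
    set T := expNegSector (Real.pi / 2 - θ) (shiftGraph (dirichletToNeumann Ω A) κ)
    obtain ⟨ψ', ⟨hψ0', hψ'⟩, hS⟩ := exists_isAnalyticSemigroup_expNeg
      ⟨_, ⟨hψ0, hψ⟩, _, hT.exp_smul hψ0⟩
    -- `e^{-s N} = e^{κ s} e^{-s N_κ}`, so the bounds for `N` hold for `N_κ`
    have hle : ∀ (s : ℝ), 0 < s → ∀ (f : L2Bdry m Ω) (v : ℝ≥0∞),
        eLpNorm (T s f) v (surfaceMeasure Ω) ≤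
          eLpNorm (expNeg (dirichletToNeumann Ω A) s f) v (surfaceMeasure Ω) := by
      intro s hs f v
      rw [← (hT.exp_smul hψ0).eq_of_pos hS hψ0 hψ hψ0' hψ' hs, smul_apply, eLpNorm_smul_Lp]
      refine le_mul_of_one_le_left' ?_
      rw [← ofReal_norm, ← Complex.ofReal_mul, Complex.norm_exp_ofReal, ENNReal.one_le_ofReal]
      exact Real.one_le_exp (mul_nonneg hκ.1.le hs.le)
    have hcontr : ∀ z ∈ openSector (Real.pi / 2 - θ), ∀ f : L2Bdry m Ω,
        eLpNorm (T z f) 2 (surfaceMeasure Ω) ≤ eLpNorm f 2 (surfaceMeasure Ω) := by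
      intro z hz f
      rw [← Lp.enorm_def, ← Lp.enorm_def, ← ofReal_norm, ← ofReal_norm]
      exact ENNReal.ofReal_le_ofReal (hT.norm_apply_le hnum hθ0 hθ hz f)
    intro z hz f hf E F hE _
    have hz0 : 0 < ‖z‖ := norm_pos_iff.2 hz.1
    obtain ⟨ζ, hζ⟩ : ∃ ζ : ℂ, ζ = ((‖z‖⁻¹ : ℝ) : ℂ) * z := ⟨_, rfl⟩
    have hzζ : (‖z‖ : ℂ) * ζ = z := by
      rw [hζ, ← mul_assoc, ← Complex.ofReal_mul, mul_inv_cancel₀ hz0.ne', Complex.ofReal_one,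
        one_mul]
    have hζ1 : ‖ζ‖ = 1 := by
      rw [hζ, norm_mul, Complex.norm_real, Real.norm_of_nonneg (by positivity),
        inv_mul_cancel₀ hz0.ne']
    have hζarg : ζ.arg = z.arg := by
      rw [hζ, Complex.arg_real_mul _ (by positivity)]
    have hζ0 : ζ ≠ 0 := by
      rw [← norm_pos_iff, hζ1]
      exact one_pos
    have hζs : ζ ∈ openSector (Real.pi / 2 - θ) := ⟨hζ0, by rw [hζarg]; exact hz.2.trans_lt hφ⟩
    have hsplit : ∀ s : ℝ, 0 < s → (s : ℂ) * ζ - (δ * s : ℝ) ∈ openSector (Real.pi / 2 - θ) := by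
      intro s hs
      have h1 : (s : ℂ) * ζ ∈ sector φ := by
        refine ⟨mul_ne_zero (by exact_mod_cast hs.ne') hζ0, ?_⟩
        rw [Complex.arg_real_mul _ hs, hζarg]
        exact hz.2
      have h2 := hδ _ h1
      rwa [norm_mul, Complex.norm_real, Real.norm_of_nonneg hs.le, hζ1, mul_one] at h2
    have hδs : ∀ s : ℝ, 0 < s → ((δ * s : ℝ) : ℂ) ∈ openSector (Real.pi / 2 - θ) := fun s hs =>
      ofReal_mem_openSector hψ0 (mul_pos hδ0 hs)
    -- the sum `z = (z - δ |z|) + δ |z|` splits off a contraction, and the bounds for `N` apply to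
    -- the remaining real time
    have := offDiagonal_ray hT hψ0 hψ hζs hζ1 hp hq (K₁ := K₁ * (δ ^ (-a)).toNNReal)
      (K₂ := K₂ * (δ ^ (-b)).toNNReal) ha0 ha1 hb0 hb1 (hC.exists_shift κ) ?_ ?_ hz0 hf hE (F := F)
    · rwa [hzζ, ← hpq, ofReal_norm] at this
    · intro s hs f hf
      have hadd := hT.add _ (hsplit s hs) _ (hδs s hs)
      rw [sub_add_cancel] at hadd
      rw [hadd, ContinuousLinearMap.comp_apply]
      refine ((hcontr _ (hsplit s hs) _).trans (hle _ (mul_pos hδ0 hs) _ _)).trans ?_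
      refine (hK₁.eLpNorm_le ⟨_, mul_pos hδ0 hs, rfl⟩ hf).trans ?_
      rw [hpr, hnorm _ (mul_pos hδ0 hs), ENNReal.coe_mul,
        mul_assoc (K₁ : ℝ≥0∞) ((δ ^ (-a)).toNNReal : ℝ≥0∞)]
      gcongr
      exact min_ofReal_mul_rpow_neg_le ha0 hδ0 hδ1
    · intro s hs f hf
      have hadd := hT.add _ (hδs s hs) _ (hsplit s hs)
      rw [add_sub_cancel] at hadd
      rw [hadd, ContinuousLinearMap.comp_apply]
      refine (hle _ (mul_pos hδ0 hs) _ _).trans ?_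
      refine (hK₂.eLpNorm_le ⟨_, mul_pos hδ0 hs, rfl⟩ (Lp.memLp _)).trans ?_
      rw [hrq, hnorm _ (mul_pos hδ0 hs), ENNReal.coe_mul,
        mul_assoc (K₂ : ℝ≥0∞) ((δ ^ (-b)).toNNReal : ℝ≥0∞)]
      gcongr
      · exact min_ofReal_mul_rpow_neg_le hb0 hδ0 hδ1
      · exact hcontr _ (hsplit s hs) f
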